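/- **Setting.** Let $X_1,\dots,X_n\in\mathbb{R}^d$, $Y\in\mathbb{R}^n$, and let $\mathcal{D}\subset\mathbb{R}^d$ be a nonempty closed convex set. Put $A=e_n\otimes I_n-I_n\otimes e_n\in\mathbb{R}^{n^2\times n}$ and $B=\mathrm{Diag}(B_1,\dots,B_n)\in\mathbb{R}^{n^2\times dn}$ with $B_i=e_nX_i^T-X^T$, $X=(X_1,\dots,X_n)$. For $\xi=(\xi_1;\dots;\xi_n)\in\mathbb{R}^{dn}$ let $p(\xi)=\sum_{i=1}^n\delta_{\mathcal{D}}(\xi_i)$, and let $\delta_+$ and $\Pi_+$ be the indicator function of, and the projection onto, $\mathbb{R}^{n^2}_+$. Consider $$\text{(P)}\quad \min_{\theta\in\mathbb{R}^n,\ \xi\in\mathbb{R}^{dn}}\ \tfrac12\|\theta-Y\|^2+p(\xi)+\delta_+(A\theta+B\xi),$$ $$\text{(D)}\quad \max_{u\in\mathbb{R}^{n^2},\ v\in\mathbb{R}^{dn}}\ -\tfrac12\|A^Tu\|^2-\langle Y,A^Tu\rangle-p^*(-v)-\delta_+(u)\quad\text{s.t. } B^Tu+v=0,$$ with the KKT conditions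 $$\theta-Y-A^Tu=0,\quad B^Tu+v=0,\quad -v\in\partial p(\xi),\quad -u\in\partial\delta_+(A\theta+B\xi).$$ Let $l(\theta,\xi;u,v)=\tfrac12\|\theta-Y\|^2-p^*(-v)-\langle v,\xi\rangle-\delta_+(u)-\langle u,A\theta+B\xi\rangle$ be the Lagrangian, $\mathcal{T}_l(\theta,\xi,u,v)=\{(\theta',\xi',u',v')\mid(\theta',\xi',-u',-v')\in\partial l(\theta,\xi,u,v)\}$ (convex subgradients in $(\theta,\xi)$, concave supergradients in $(u,v)$), and $\Lambda:=\mathcal{T}_l^{-1}(0)$. With the Moreau envelope $\mathrm{E}_q(x)=\min_y\{q(y)+\tfrac12\|y-x\|^2\}$ and its minimizer $\mathrm{Prox}_q(x)$, the augmented Lagrangian is, for $\sigma>0$, $$\mathcal{L}_\sigma(\theta,\xi;u,v)=\tfrac12\|\theta-Y\|^2+\sigma \mathrm{E}_p(\xi-\tfrac v\sigma)+\sigma \mathrm{E}_{\delta_+}(A\theta+B\xi-\tfrac u\sigma)-\tfrac1{2\sigma}\|u\|^2-\tfrac1{2\sigma}\|v\|^2 .$$ **Algorithm.** Let $H_1\in\mathbb{R}^{n\times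 n}$, $H_2\in\mathbb{R}^{dn\times dn}$ be symmetric positive definite, $\varepsilon_k\ge0$ summable, $0<\sigma_0\le\sigma_1\le\cdots$ with $\sigma_k\uparrow\sigma_\infty\le\infty$. Put $\Sigma=\mathrm{Diag}(H_1,H_2,I_{n^2},I_{dn})$, $\|z\|_\Sigma=\sqrt{\langle z,\Sigma z\rangle}$, $\mathrm{dist}_\Sigma(z,C)=\inf_{w\in C}\|z-w\|_\Sigma$, $\lambda_{\min}=\min\{\lambda_{\min}(H_1),\lambda_{\min}(H_2),1\}$, $\lambda_{\max}=\max\{\lambda_{\max}(H_1),\lambda_{\max}(H_2),1\}$. Let $z^k=(\theta^k,\xi^k,u^k,v^k)$, $k\ge0$, be an infinite sequence, with arbitrary $z^0$, such that for every $k\ge 0$, with $\Phi_k(\theta,\xi)=\mathcal{L}_{\sigma_k}(\theta,\xi;u^k,v^k)+\tfrac1{2\sigma_k}\|\theta-\theta^k\|_{H_1}^2+\tfrac1{2\sigma_k}\|\xi-\xi^k\|_{H_2}^2$, $$\text{(A)}\quad\|\nabla\Phi_k(\theta^{k+1},\xi^{k+1})\|\le\frac{\sqrt{\lambda_{\min}}}{\sigma_k}\varepsilon_k,$$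 $$u^{k+1}=-\sigma_k\big[A\theta^{k+1}+B\xi^{k+1}-u^k/\sigma_k-\Pi_+(A\theta^{k+1}+B\xi^{k+1}-u^k/\sigma_k)\big],$$ $$v^{k+1}=-\sigma_k\big[\xi^{k+1}-v^k/\sigma_k-\mathrm{Prox}_p(\xi^{k+1}-v^k/\sigma_k)\big].$$ **Theorem.** Suppose that the solution set of the KKT conditions is nonempty. This set is exactly $\Lambda$, and the following hold. (1) The sequence $\{z^k\}$ is bounded, $\{(\theta^k,\xi^k)\}$ converges to an optimal solution of (P), and $\{(u^k,v^k)\}$ converges to an optimal solution of (D). (2) Let $r:=\sum_{k=0}^\infty\varepsilon_k+\mathrm{dist}_\Sigma(z^0,\Lambda)$. Assume that there is $\kappa>0$ such that $\mathrm{dist}(z,\Lambda)\le\kappa\,\mathrm{dist}(0,\mathcal{T}_l(z))$ for all $z$ with $\mathrm{dist}(z,\Lambda)\le r$ (where $\mathrm{dist}(0,\emptyset)=+\infty$), and that, in addition to (A), for all $k\ge 0$, $$\text{(B)}\quad\|\nabla\Phi_k(\theta^{k+1},\xi^{k+1})\|\le\frac{\delta_k\sqrt{\lambda_{\min}}}{\sigma_k}\|z^{k+1}-z^k\|_\Sigma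 ,$$ where $0\le\delta_k<1$ and $\sum_k\delta_k<\infty$. Then for all $k\ge0$ $$\mathrm{dist}_\Sigma(z^{k+1},\Lambda)\le\mu_k\,\mathrm{dist}_\Sigma(z^k,\Lambda),$$ where $$\mu_k=\frac1{1-\delta_k}\Big(\delta_k+\frac{(1+\delta_k)\kappa\lambda_{\max}}{\sqrt{\sigma_k^2+\kappa^2\lambda_{\max}^2}}\Big)\ \longrightarrow\ \mu_\infty=\frac{\kappa\lambda_{\max}}{\sqrt{\sigma_\infty^2+\kappa^2\lambda_{\max}^2}}<1$$ (read $\mu_\infty=0$ if $\sigma_\infty=\infty$). Moreover $\mu_\infty\to0$ as $\sigma_\infty\to\infty$. -/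

import Mathlib

open Filter Topology

noncomputable section

namespace ProxALM

/-! ### Extended-valued convex analysis -/

section Convex

variable {E : Type*} [NormedAddCommGroup E] [InnerProductSpace ℝ E]

open Classical in
/-- The indicator function `δ_C` of a set: `0` on `C` and `+∞` elsewhere. -/
def ind (C : Set E) (x : E) : EReal := if x ∈ C then 0 else ⊤

/-- The convex conjugate `q*(z) = sup_x (⟨x, z⟩ - q x)`. -/
def conj (q : E → EReal) (z : E) : EReal := ⨆ x : E, ((inner ℝ x z : ℝ) : EReal) - q x

/-- The convex subdifferential of an extended-valued function. -/
def subdiff (q : E → EReal) (x : E) : Set E :=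
  {g | ∀ y : E, q x + ((inner ℝ g (y - x) : ℝ) : EReal) ≤ q y}

/-- The objective `y ↦ q y + ½‖y - x‖²` that defines the Moreau envelope at `x`. -/
def proxObj (q : E → EReal) (x y : E) : EReal := q y + ((1 / 2 * ‖y - x‖ ^ 2 : ℝ) : EReal)

/-- The Moreau envelope `E_q(x) = min_y (q y + ½‖y - x‖²)`, which is finite-valued for
closed proper convex `q`. -/
def moreau (q : E → EReal) (x : E) : ℝ := (⨅ y : E, proxObj q x y).toReal

/-- The proximal mapping: the minimizer of `y ↦ q y + ½‖y - x‖²`, which exists and is unique for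
closed proper convex `q`. -/
def prox (q : E → EReal) (x : E) : E :=
  Classical.epsilon fun y : E => ∀ y' : E, proxObj q x y ≤ proxObj q x y'

end Convex

/-! ### Spaces -/

/-- The space `ℝⁿ` of `θ`. -/
abbrev ThetaSp (n : ℕ) := EuclideanSpace ℝ (Fin n)

/-- The space `ℝ^{dn}` of `ξ = (ξ₁; …; ξₙ)`; the entry `(i, j)` is the `j`-th entry of `ξᵢ`. -/
abbrev XiSp (n d : ℕ) := EuclideanSpace ℝ (Fin n × Fin d)

/-- The space `ℝ^{n²}` of `u`. -/
abbrev USp (n : ℕ) := EuclideanSpace ℝ (Fin n × Fin n)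

/-- Pairs `(θ, ξ)` with the Euclidean norm. -/
abbrev Primal (n d : ℕ) := WithLp 2 (ThetaSp n × XiSp n d)

/-- Pairs `(u, v)` with the Euclidean norm. -/
abbrev Dual (n d : ℕ) := WithLp 2 (USp n × XiSp n d)

/-- Quadruples `(θ, ξ, u, v) = ((θ, ξ), (u, v))` with the Euclidean norm. -/
abbrev PD (n d : ℕ) := WithLp 2 (Primal n d × Dual n d)

/-- A matrix acting on Euclidean space. -/
abbrev act {ι κ : Type*} [Fintype κ] [DecidableEq κ] (M : Matrix ι κ ℝ)
    (x : EuclideanSpace ℝ κ) : EuclideanSpace ℝ ι := Matrix.toEuclideanLin M x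

/-- The nonnegative orthant `ℝ₊^{n²}`. -/
def orthant (n : ℕ) : Set (USp n) := {w | ∀ i, 0 ≤ w i}

/-! ### The primal and dual problems -/

/-- Data of the shape-constrained regression problem: design points `X₁, …, Xₙ ∈ ℝᵈ`, responses
`Y ∈ ℝⁿ` and the constraint set `D ⊆ ℝᵈ`. -/
structure Data (n d : ℕ) where
  X : Fin n → EuclideanSpace ℝ (Fin d)
  Y : ThetaSp n
  D : Set (EuclideanSpace ℝ (Fin d))

/-- `A = eₙ ⊗ Iₙ - Iₙ ⊗ eₙ`; row `(i, j)` sends `θ` to `θⱼ - θᵢ`. -/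
def matA (n : ℕ) : Matrix (Fin n × Fin n) (Fin n) ℝ :=
  Matrix.of fun r c => (if r.2 = c then 1 else 0) - (if r.1 = c then 1 else 0)

/-- The `i`-th block `ξᵢ ∈ ℝᵈ` of `ξ`. -/
def block {n d : ℕ} (ξ : XiSp n d) (i : Fin n) : EuclideanSpace ℝ (Fin d) :=
  WithLp.toLp 2 fun j => ξ (i, j)

namespace Data

variable {n d : ℕ} (P : Data n d)

/-- `B = Diag(B₁, …, Bₙ)` with `Bᵢ = eₙ Xᵢᵀ - Xᵀ`; row `(i, j)` sends `ξ` to `⟨Xᵢ - Xⱼ, ξᵢ⟩`. -/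
def matB : Matrix (Fin n × Fin n) (Fin n × Fin d) ℝ :=
  Matrix.of fun r c => if r.1 = c.1 then P.X r.1 c.2 - P.X r.2 c.2 else 0

/-- `p(ξ) = ∑ᵢ δ_D(ξᵢ)`. -/
def p (ξ : XiSp n d) : EReal := ∑ i : Fin n, ind P.D (block ξ i)

/-- `Aθ + Bξ`. -/
def cons (x : Primal n d) : USp n := act (matA n) x.fst + act P.matB x.snd

/-- The objective of (P): `½‖θ - Y‖² + p(ξ) + δ₊(Aθ + Bξ)`. -/
def primalObj (x : Primal n d) : EReal :=
  ((1 / 2 * ‖x.fst - P.Y‖ ^ 2 : ℝ) : EReal) + P.p x.snd + ind (orthant n) (P.cons x)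

/-- `x = (θ, ξ)` is an optimal solution of (P). -/
def IsPrimalOptimal (x : Primal n d) : Prop :=
  P.primalObj x ≠ ⊤ ∧ ∀ x', P.primalObj x ≤ P.primalObj x'

/-- The objective of (D): `-½‖Aᵀu‖² - ⟨Y, Aᵀu⟩ - p*(-v) - δ₊(u)`. -/
def dualObj (y : Dual n d) : EReal :=
  ((-(1 / 2) * ‖act (matA n).transpose y.fst‖ ^ 2
      - inner ℝ P.Y (act (matA n).transpose y.fst) : ℝ) : EReal)
    - conj P.p (-y.snd) - ind (orthant n) y.fst

/-- The constraint `Bᵀu + v = 0` of (D). -/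
def DualConstraint (y : Dual n d) : Prop := act P.matB.transpose y.fst + y.snd = 0

/-- `y = (u, v)` is an optimal solution of (D). -/
def IsDualOptimal (y : Dual n d) : Prop :=
  P.DualConstraint y ∧ P.dualObj y ≠ ⊥ ∧ ∀ y', P.DualConstraint y' → P.dualObj y' ≤ P.dualObj y

/-- The solution set of the KKT conditions
`θ - Y - Aᵀu = 0`, `Bᵀu + v = 0`, `-v ∈ ∂p(ξ)`, `-u ∈ ∂δ₊(Aθ + Bξ)`. -/
def kktSet : Set (PD n d) :=
  {z | z.fst.fst - P.Y - act (matA n).transpose z.snd.fst = 0 ∧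
    act P.matB.transpose z.snd.fst + z.snd.snd = 0 ∧
    -z.snd.snd ∈ subdiff P.p z.fst.snd ∧
    -z.snd.fst ∈ subdiff (ind (orthant n)) (P.cons z.fst)}

/-- The Lagrangian
`l(θ, ξ; u, v) = ½‖θ - Y‖² - p*(-v) - ⟨v, ξ⟩ - δ₊(u) - ⟨u, Aθ + Bξ⟩`. -/
def lagr (x : Primal n d) (y : Dual n d) : EReal :=
  ((1 / 2 * ‖x.fst - P.Y‖ ^ 2 - inner ℝ y.snd x.snd - inner ℝ y.fst (P.cons x) : ℝ) : EReal)
    - conj P.p (-y.snd) - ind (orthant n) y.fst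

/-- The operator `T_l`: `(x', y') ∈ T_l(x, y)` iff `(x', -y') ∈ ∂l(x, y)`, where `∂l` is the
subdifferential of the convex-concave function `l`: the convex subgradients in `x = (θ, ξ)` paired
with the concave supergradients in `y = (u, v)`. -/
def Tl (z : PD n d) : Set (PD n d) :=
  {w | (∀ x, P.lagr z.fst z.snd + ((inner ℝ w.fst (x - z.fst) : ℝ) : EReal) ≤ P.lagr x z.snd) ∧
    (∀ y, P.lagr z.fst y ≤
      P.lagr z.fst z.snd + ((inner ℝ (-w.snd) (y - z.snd) : ℝ) : EReal))}

/-- `Λ = T_l⁻¹(0)`. -/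
def Lam : Set (PD n d) := {z | 0 ∈ P.Tl z}

/-- The augmented Lagrangian
`½‖θ - Y‖² + σ E_p(ξ - v/σ) + σ E_{δ₊}(Aθ + Bξ - u/σ) - ‖u‖²/(2σ) - ‖v‖²/(2σ)`. -/
def augLagr (σ : ℝ) (x : Primal n d) (y : Dual n d) : ℝ :=
  1 / 2 * ‖x.fst - P.Y‖ ^ 2 + σ * moreau P.p (x.snd - σ⁻¹ • y.snd)
    + σ * moreau (ind (orthant n)) (P.cons x - σ⁻¹ • y.fst)
    - 1 / (2 * σ) * ‖y.fst‖ ^ 2 - 1 / (2 * σ) * ‖y.snd‖ ^ 2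

end Data

/-! ### Weighted norms, eigenvalues -/

/-- `‖x‖_H = √⟨x, H x⟩`. -/
def wnorm {ι : Type*} [Fintype ι] [DecidableEq ι] (H : Matrix ι ι ℝ)
    (x : EuclideanSpace ℝ ι) : ℝ := √(inner ℝ x (act H x))

/-- The largest eigenvalue of a symmetric matrix. -/
def eigMax {ι : Type*} [Fintype ι] [DecidableEq ι] (H : Matrix ι ι ℝ) : ℝ := sSup (spectrum ℝ H)

/-- The smallest eigenvalue of a symmetric matrix. -/
def eigMin {ι : Type*} [Fintype ι] [DecidableEq ι] (H : Matrix ι ι ℝ) : ℝ := sInf (spectrum ℝ H)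

section Algorithm

variable {n d : ℕ} (P : Data n d)
  (H₁ : Matrix (Fin n) (Fin n) ℝ) (H₂ : Matrix (Fin n × Fin d) (Fin n × Fin d) ℝ)

/-- `λ_max = max{λ_max(H₁), λ_max(H₂), 1}`. -/
def lamMax : ℝ := max (eigMax H₁) (max (eigMax H₂) 1)

/-- `λ_min = min{λ_min(H₁), λ_min(H₂), 1}`. -/
def lamMin : ℝ := min (eigMin H₁) (min (eigMin H₂) 1)

/-- `‖z‖_Σ` for `Σ = Diag(H₁, H₂, I, I)`. -/
def normSig (z : PD n d) : ℝ :=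
  √(inner ℝ z.fst.fst (act H₁ z.fst.fst) + inner ℝ z.fst.snd (act H₂ z.fst.snd)
    + ‖z.snd.fst‖ ^ 2 + ‖z.snd.snd‖ ^ 2)

/-- `dist_Σ(z, C) = inf {‖z - w‖_Σ | w ∈ C}`, for nonempty `C`. -/
def distSig (z : PD n d) (C : Set (PD n d)) : ℝ := ⨅ w : C, normSig H₁ H₂ (z - w)

/-- The subproblem objective `Φ_k` at the current iterate `z` and with penalty `σ`:
`L_σ(θ, ξ; u, v) + ‖θ - θᵏ‖²_{H₁}/(2σ) + ‖ξ - ξᵏ‖²_{H₂}/(2σ)`. -/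
def Phi (σ : ℝ) (z : PD n d) (x : Primal n d) : ℝ :=
  P.augLagr σ x z.snd + 1 / (2 * σ) * wnorm H₁ (x.fst - z.fst.fst) ^ 2
    + 1 / (2 * σ) * wnorm H₂ (x.snd - z.fst.snd) ^ 2

/-- `z` is an infinite sequence of iterates `(θᵏ, ξᵏ, uᵏ, vᵏ)` of the proximal augmented Lagrangian
method with penalties `σ` and tolerances `ε`: the inexact minimization with criterion (A) and the
multiplier updates. -/
structure IsIterates (σ ε : ℕ → ℝ) (z : ℕ → PD n d) : Prop where
  critA : ∀ k, ‖gradient (Phi P H₁ H₂ (σ k) (z k)) (z (k + 1)).fst‖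
    ≤ √(lamMin H₁ H₂) / σ k * ε k
  update_u : ∀ k, (z (k + 1)).snd.fst =
    -(σ k • (P.cons (z (k + 1)).fst - (σ k)⁻¹ • (z k).snd.fst
      - prox (ind (orthant n)) (P.cons (z (k + 1)).fst - (σ k)⁻¹ • (z k).snd.fst)))
  update_v : ∀ k, (z (k + 1)).snd.snd =
    -(σ k • ((z (k + 1)).fst.snd - (σ k)⁻¹ • (z k).snd.snd
      - prox P.p ((z (k + 1)).fst.snd - (σ k)⁻¹ • (z k).snd.snd)))

/-- The stopping criterion (B). -/
def CritB (σ δ : ℕ → ℝ) (z : ℕ → PD n d) : Prop :=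
  ∀ k, ‖gradient (Phi P H₁ H₂ (σ k) (z k)) (z (k + 1)).fst‖
    ≤ δ k * √(lamMin H₁ H₂) / σ k * normSig H₁ H₂ (z (k + 1) - z k)

/-- The error bound condition `dist(z, Λ) ≤ κ dist(0, T_l(z))` whenever `dist(z, Λ) ≤ r`, with the
convention that the distance to the empty set is `+∞`. -/
def ErrorBound (κ r : ℝ) : Prop :=
  ∀ z : PD n d, Metric.infDist z P.Lam ≤ r →
    ENNReal.ofReal (Metric.infDist z P.Lam)
      ≤ ENNReal.ofReal κ * Metric.infEDist (0 : PD n d) (P.Tl z)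

end Algorithm

/-- `μ_k` as a function of `κ`, `λ_max`, `σ_k` and `δ_k`. -/
def mu (κ lam σ δ : ℝ) : ℝ :=
  1 / (1 - δ) * (δ + (1 + δ) * κ * lam / √(σ ^ 2 + κ ^ 2 * lam ^ 2))

/-- `μ_∞ = κ λ_max / √(σ_∞² + κ² λ_max²)`, which is `0` for `σ_∞ = +∞`. -/
def muInf (κ lam : ℝ) (σinf : EReal) : ℝ :=
  if σinf = ⊤ then 0 else κ * lam / √(σinf.toReal ^ 2 + κ ^ 2 * lam ^ 2)

end ProxALM

end

/-! The method is an inexact proximal point method for `T_l`, preconditioned by Σ. Fenchel duality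
turns `T_l` into the gradient of the smooth part of the Lagrangian together with two normal-cone
inclusions (`mem_Tl_iff`). From this form it is monotone, has closed graph and has resolvents
everywhere. The multiplier updates are what differentiating the Moreau envelopes produces, so
σₖ⁻¹Σ(zᵏ - zᵏ⁺¹) + (∇Φₖ, 0) lies in `T_l`(zᵏ⁺¹) (`step_mem_Tl`). Replacing zᵏ by a nearby point aᵏ
absorbs the gradient error, and criteria (A) and (B) bound the Σ-norm of aᵏ - zᵏ.

For (1), monotonicity gives a Pythagorean inequality towards every zero of `T_l` (`fejer_step`).
Distances to zeros converge, steps vanish, a cluster point is a zero by closedness of the graph, and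
hence the whole sequence converges to it. Zeros are KKT points, and these are optimal for (P) and
(D).

For (2), the same inequality combined with the error bound at zᵏ⁺¹ yields μₖ
(`dist_step_le_mu_mul`). One gap has to be closed: the iterates satisfy dist_Σ ≤ r, while the error
bound is assumed where the Euclidean distance is at most r, and the latter may be larger if λ_min <
1. Beyond Euclidean distance r, maximal monotonicity still gives r ≤ κ‖g‖ for every value g of `T_l`
(`le_mul_norm_of_le_infDist`), and dist_Σ ≤ r then suffices. -/

noncomputable section

namespace ProxALM

/-! ### Indicator functions: subgradients, conjugates, projections, Moreau envelopes. -/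

section ConvexSets

variable {E : Type*} [NormedAddCommGroup E] [InnerProductSpace ℝ E] {C : Set E}

/-- The normal cone of a set at a point, empty at points outside the set. -/
def normalCone (C : Set E) (q : E) : Set E :=
  {g | q ∈ C ∧ ∀ q' ∈ C, inner ℝ g (q' - q) ≤ 0}

theorem ind_of_mem {E : Type*} {C : Set E} {x : E} (hx : x ∈ C) : ind C x = 0 := by simp [ind, hx]

theorem ind_of_notMem {E : Type*} {C : Set E} {x : E} (hx : x ∉ C) : ind C x = ⊤ := by simp [ind, hx]

/-- Nonemptiness forces x ∈ C: for empty C the indicator is constantly ⊤ and every vector would be a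
subgradient. -/
theorem subdiff_ind (hne : C.Nonempty) (x : E) : subdiff (ind C) x = normalCone C x := by
  ext g
  constructor
  · intro h
    have hx : x ∈ C := by
      by_contra hx
      obtain ⟨q, hq⟩ := hne
      have := h q
      rw [ind_of_notMem hx, ind_of_mem hq, EReal.top_add_coe] at this
      simp at this
    refine ⟨hx, fun q hq => ?_⟩
    have := h q
    rw [ind_of_mem hx, ind_of_mem hq, zero_add] at this
    exact_mod_cast this
  · rintro ⟨hx, h⟩ y
    by_cases hy : y ∈ C
    · rw [ind_of_mem hx, ind_of_mem hy, zero_add]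
      exact_mod_cast h y hy
    · rw [ind_of_notMem hy]
      exact le_top

theorem inner_le_conj_ind {q : E} (hq : q ∈ C) (g : E) :
    ((inner ℝ q g : ℝ) : EReal) ≤ conj (ind C) g := by
  have := le_iSup (fun x : E => ((inner ℝ x g : ℝ) : EReal) - ind C x) q
  rw [ind_of_mem hq, sub_zero] at this
  exact this

theorem conj_ind_le {g : E} {t : EReal} (h : ∀ q ∈ C, ((inner ℝ q g : ℝ) : EReal) ≤ t) :
    conj (ind C) g ≤ t := by
  refine iSup_le fun x => ?_
  by_cases hx : x ∈ C
  · simpa [ind_of_mem hx] using h x hx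
  · simp [ind_of_notMem hx]

theorem conj_ind_ne_bot (hne : C.Nonempty) (g : E) : conj (ind C) g ≠ ⊥ := by
  obtain ⟨q, hq⟩ := hne
  exact ne_bot_of_le_ne_bot (EReal.coe_ne_bot _) (inner_le_conj_ind hq g)

theorem conj_ind_zero (hne : C.Nonempty) : conj (ind C) (0 : E) = 0 := by
  obtain ⟨q, hq⟩ := hne
  refine le_antisymm (conj_ind_le fun q _ => by simp) ?_
  simpa using inner_le_conj_ind hq (0 : E)

theorem conj_ind_eq_of_mem_normalCone {g q : E} (h : g ∈ normalCone C q) :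
    conj (ind C) g = ((inner ℝ q g : ℝ) : EReal) := by
  refine le_antisymm (conj_ind_le fun q' hq' => ?_) (inner_le_conj_ind h.1 g)
  have := h.2 q' hq'
  rw [inner_sub_right, real_inner_comm, real_inner_comm q g] at this
  exact_mod_cast (by linarith : inner ℝ q' g ≤ inner ℝ q g)

variable [CompleteSpace E]

/-- The projection theorem supplies a minimizer, so the choice operator in `prox` returns one, and
the variational inequality characterizes it. -/
theorem prox_ind_spec (hne : C.Nonempty) (hcl : IsClosed C) (hcv : Convex ℝ C) (x : E) :
    x - prox (ind C) x ∈ normalCone C (prox (ind C) x) := by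
  obtain ⟨q, hq, hmin⟩ := exists_norm_eq_iInf_of_complete_convex hne hcl.isComplete hcv x
  have hbdd : BddBelow (Set.range fun w : C => ‖x - w‖) :=
    ⟨0, by rintro _ ⟨w, rfl⟩; exact norm_nonneg _⟩
  have hle : ∀ y ∈ C, ‖x - q‖ ≤ ‖x - y‖ := fun y hy => by
    rw [hmin]; exact ciInf_le hbdd ⟨y, hy⟩
  have hex : ∃ y : E, ∀ y' : E, proxObj (ind C) x y ≤ proxObj (ind C) x y' := by
    refine ⟨q, fun y' => ?_⟩
    by_cases hy : y' ∈ C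
    · simp only [proxObj, ind_of_mem hq, ind_of_mem hy, zero_add]
      have := hle y' hy
      rw [norm_sub_rev x q, norm_sub_rev x y'] at this
      norm_cast
      gcongr
    · simp only [proxObj, ind_of_notMem hy, EReal.top_add_coe]
      exact le_top
  have hspec : ∀ y' : E, proxObj (ind C) x (prox (ind C) x) ≤ proxObj (ind C) x y' :=
    Classical.epsilon_spec hex
  have hmem : prox (ind C) x ∈ C := by
    by_contra hx
    have := hspec q
    simp only [proxObj, ind_of_notMem hx, ind_of_mem hq, EReal.top_add_coe, zero_add] at this
    exact EReal.coe_ne_top _ (top_le_iff.mp this)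
  refine ⟨hmem, (norm_eq_iInf_iff_real_inner_le_zero hcv hmem).1 (le_antisymm ?_ ?_)⟩
  · have : Nonempty C := ⟨⟨q, hq⟩⟩
    refine le_ciInf fun w => ?_
    have := hspec w
    simp only [proxObj, ind_of_mem hmem, ind_of_mem w.2, zero_add] at this
    have h2 : (1 / 2 * ‖prox (ind C) x - x‖ ^ 2 : ℝ) ≤ 1 / 2 * ‖(w : E) - x‖ ^ 2 := by
      exact_mod_cast this
    rw [norm_sub_rev, norm_sub_rev x]
    exact le_of_sq_le_sq (by linarith) (norm_nonneg _)
  · exact ciInf_le hbdd ⟨_, hmem⟩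

theorem norm_sub_prox_le (hne : C.Nonempty) (hcl : IsClosed C) (hcv : Convex ℝ C) (x : E) {q : E}
    (hq : q ∈ C) : ‖x - prox (ind C) x‖ ^ 2 ≤ ‖x - q‖ ^ 2 := by
  have h := (prox_ind_spec hne hcl hcv x).2 q hq
  have h1 : x - q = (x - prox (ind C) x) - (q - prox (ind C) x) := by abel
  rw [h1, norm_sub_sq_real (x - prox (ind C) x)]
  nlinarith [sq_nonneg ‖q - prox (ind C) x‖]

theorem moreau_ind (hne : C.Nonempty) (hcl : IsClosed C) (hcv : Convex ℝ C) (x : E) :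
    moreau (ind C) x = 1 / 2 * ‖x - prox (ind C) x‖ ^ 2 := by
  have h : (⨅ y : E, proxObj (ind C) x y) = ((1 / 2 * ‖x - prox (ind C) x‖ ^ 2 : ℝ) : EReal) := by
    refine le_antisymm ?_ (le_iInf fun y => ?_)
    · refine (iInf_le _ (prox (ind C) x)).trans_eq ?_
      simp only [proxObj, ind_of_mem (prox_ind_spec hne hcl hcv x).1, zero_add]
      rw [norm_sub_rev]
    · by_cases hy : y ∈ C
      · simp only [proxObj, ind_of_mem hy, zero_add]
        have := norm_sub_prox_le hne hcl hcv x hy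
        rw [norm_sub_rev x y] at this
        exact_mod_cast (by linarith :
          1 / 2 * ‖x - prox (ind C) x‖ ^ 2 ≤ 1 / 2 * ‖y - x‖ ^ 2)
      · simp only [proxObj, ind_of_notMem hy, EReal.top_add_coe]
        exact le_top
  rw [moreau, h, EReal.toReal_coe]

/-- The Moreau envelope of an indicator function, half the squared distance, has gradient
`x - Prox x`. -/
theorem hasGradientAt_moreau_ind (hne : C.Nonempty) (hcl : IsClosed C) (hcv : Convex ℝ C) (x : E) :
    HasGradientAt (moreau (ind C)) (x - prox (ind C) x) x := by
  -- The variational inequalities at the two projections place the linearization remainder between 0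
  -- and ½‖y - x‖².
  have key : ∀ y : E, |moreau (ind C) y - moreau (ind C) x
      - inner ℝ (x - prox (ind C) x) (y - x)| ≤ 1 / 2 * ‖y - x‖ ^ 2 := by
    intro y
    rw [moreau_ind hne hcl hcv, moreau_ind hne hcl hcv]
    have hx := prox_ind_spec hne hcl hcv x
    have hy := prox_ind_spec hne hcl hcv y
    have h1 := hx.2 _ hy.1
    have h2 := hy.2 _ hx.1
    have e : y - x = prox (ind C) y - prox (ind C) x
        + ((y - prox (ind C) y) - (x - prox (ind C) x)) := by abel
    rw [← neg_sub (prox (ind C) y) (prox (ind C) x), inner_neg_right] at h2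
    rw [e]
    generalize x - prox (ind C) x = a at *
    generalize y - prox (ind C) y = b at *
    generalize prox (ind C) y - prox (ind C) x = c at *
    rw [norm_add_sq_real c, norm_sub_sq_real b, inner_add_right, inner_sub_right, inner_sub_right,
      real_inner_self_eq_norm_sq, real_inner_comm b c, real_inner_comm a c, real_inner_comm b a]
    have hbn := sq_nonneg ‖c‖
    have hd : 0 ≤ ‖b - a‖ ^ 2 := sq_nonneg _
    rw [norm_sub_sq_real b] at hd
    rw [abs_le]
    constructor <;> nlinarith
  rw [hasGradientAt_iff_isLittleO]
  refine Asymptotics.IsBigO.trans_isLittleO (g := fun y => ‖y - x‖ ^ 2) ?_ ?_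
  · refine Asymptotics.IsBigO.of_bound (1 / 2) (Eventually.of_forall fun y => ?_)
    simpa using key y
  · have := (Asymptotics.isLittleO_pow_id (𝕜 := ℝ) (n := 2) (by norm_num)).comp_tendsto
      (k := fun y : E => ‖y - x‖) (l' := 𝓝 x)
      (by simpa using (by fun_prop : Continuous fun y : E => ‖y - x‖).tendsto x)
    exact this.of_norm_right

/-- Fenchel duality for the indicator function of a closed convex set. -/
theorem mem_normalCone_iff_conj (hne : C.Nonempty) (hcl : IsClosed C) (hcv : Convex ℝ C)
    {g q : E} {c : ℝ} (hc : conj (ind C) g = c) :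
    g ∈ normalCone C q ↔
      ∀ g' : E, ((c + inner ℝ q (g' - g) : ℝ) : EReal) ≤ conj (ind C) g' := by
  constructor
  · intro h g'
    rw [conj_ind_eq_of_mem_normalCone h] at hc
    have hc' : inner ℝ q g = c := by exact_mod_cast hc
    refine le_trans ?_ (inner_le_conj_ind h.1 g')
    rw [inner_sub_right, hc']
    simp
  · intro h
    have hq : q ∈ C := by
      have hp := prox_ind_spec hne hcl hcv q
      set p := prox (ind C) q
      -- Test with g' = g + (q - p), p the projection of q: the conjugate grows by at most ⟨p, q -
      -- p⟩, the affine minorant by ⟨q, q - p⟩, so ‖q - p‖² ≤ 0.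
      have h1 : conj (ind C) (g + (q - p)) ≤ ((c + inner ℝ p (q - p) : ℝ) : EReal) := by
        refine conj_ind_le fun q' hq' => ?_
        have h2 := inner_le_conj_ind hq' g
        rw [hc] at h2
        have h3 : inner ℝ q' g ≤ c := by exact_mod_cast h2
        have h4 := hp.2 q' hq'
        rw [real_inner_comm, inner_sub_left] at h4
        rw [inner_add_right]
        exact_mod_cast (by linarith)
      have h2 := (h _).trans h1
      have h3 : c + inner ℝ q (g + (q - p) - g) ≤ c + inner ℝ p (q - p) := by exact_mod_cast h2
      rw [add_sub_cancel_left] at h3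
      have h4 : inner ℝ (q - p) (q - p) ≤ 0 := by rw [inner_sub_left]; linarith
      rw [real_inner_self_nonpos, sub_eq_zero] at h4
      rw [h4]; exact hp.1
    refine ⟨hq, fun q' hq' => ?_⟩
    -- Testing with g' = 0 gives c ≤ ⟨q, g⟩, so q attains the supremum defining the conjugate.
    have h0 := h 0
    rw [conj_ind_zero hne] at h0
    have h1 : c + inner ℝ q (0 - g) ≤ 0 := by exact_mod_cast h0
    have h2 := inner_le_conj_ind hq' g
    rw [hc] at h2
    have h3 : inner ℝ q' g ≤ c := by exact_mod_cast h2
    rw [zero_sub, inner_neg_right] at h1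
    rw [real_inner_comm, inner_sub_left]
    linarith

end ConvexSets

/-! ### Monotone operators: extending an error bound outwards. -/

section Monotone

variable {V : Type*} [NormedAddCommGroup V] [InnerProductSpace ℝ V] {T : V → Set V}

/-- Monotonicity of a set-valued operator. -/
def IsMonotoneOp (T : V → Set V) : Prop :=
  ∀ ⦃z w z' w' : V⦄, w ∈ T z → w' ∈ T z' → 0 ≤ inner ℝ (w - w') (z - z')

/-- Monotonicity of (x, h) against (w, 0) and (z, g) is added with weights 1 - t and t; `hdef` turns
the resulting pairing into ‖h - tg‖²/η. So for small η the value h is close to tg. -/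
theorem norm_sub_smul_sq_le_of_regularized (hT : IsMonotoneOp T) {w z g x : V} {η t : ℝ}
    (hη : 0 < η) (ht0 : 0 ≤ t) (ht1 : t ≤ 1) (hw : 0 ∈ T w) (hz : g ∈ T z) {h : V}
    (hx : h ∈ T x) (hdef : h - t • g = η • ((1 - t) • w + t • z - x)) :
    ‖h - t • g‖ ^ 2 ≤ η * (t * (1 - t) * inner ℝ g (z - w)) := by
  have h1 := hT hx hw
  have h2 := hT hx hz
  rw [sub_zero] at h1
  have h3 : 0 ≤ (1 - t) * inner ℝ h (x - w) + t * inner ℝ (h - g) (x - z) :=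
    add_nonneg (mul_nonneg (by linarith) h1) (mul_nonneg ht0 h2)
  have h4 : (1 - t) * inner ℝ h (x - w) + t * inner ℝ (h - g) (x - z)
      = -inner ℝ (h - t • g) ((1 - t) • w + t • z - x) + t * (1 - t) * inner ℝ g (z - w) := by
    simp only [inner_sub_left, inner_sub_right, inner_add_right, real_inner_smul_left,
      real_inner_smul_right]
    ring
  have h5 : ‖h - t • g‖ ^ 2 = η * inner ℝ (h - t • g) ((1 - t) • w + t • z - x) := by
    rw [← real_inner_self_eq_norm_sq]
    nth_rewrite 2 [hdef]
    rw [real_inner_smul_right]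
  rw [h5]
  exact mul_le_mul_of_nonneg_left (by linarith) hη.le

/-- If a maximal monotone operator satisfies an error bound at distance exactly `r` from its zero
set, then its values stay away from `0` at any larger distance. -/
theorem le_mul_norm_of_le_infDist (hT : IsMonotoneOp T)
    (hres : ∀ η : ℝ, 0 < η → ∀ y : V, ∃ x : V, y - η • x ∈ T x)
    {κ r : ℝ} (hκ : 0 < κ) (hr : 0 ≤ r) (hne : {z | 0 ∈ T z}.Nonempty)
    (hEB : ∀ z g : V, Metric.infDist z {z | 0 ∈ T z} = r → g ∈ T z → r ≤ κ * ‖g‖)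
    {z g : V} (hg : g ∈ T z) (hz : r ≤ Metric.infDist z {z | 0 ∈ T z}) : r ≤ κ * ‖g‖ := by
  obtain ⟨w, hw⟩ := hne
  have hw0 : (0 : V) ∈ T w := hw
  set Λ := {z | 0 ∈ T z} with hΛ
  have main : ∀ η : ℝ, 0 < η → r ≤ κ * (‖g‖ + √(η * |inner ℝ g (z - w)|)) := by
    intro η hη
    choose R hR using hres η hη
    -- The resolvent R of parameter η is single-valued and Lipschitz, so it maps segments to
    -- continuous paths.
    have hRinj : ∀ {y x : V}, y - η • x ∈ T x → R y = x := by
      intro y x hx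
      have h1 := hT (hR y) hx
      have h2 : y - η • R y - (y - η • x) = -(η • (R y - x)) := by rw [smul_sub]; abel
      rw [h2, inner_neg_left, real_inner_smul_left, real_inner_self_eq_norm_sq] at h1
      have h3 : ‖R y - x‖ ^ 2 ≤ 0 := by
        by_contra! h4
        nlinarith [mul_pos hη h4]
      have h5 : ‖R y - x‖ = 0 := by
        exact pow_eq_zero_iff (two_ne_zero) |>.1 (le_antisymm h3 (sq_nonneg _))
      exact sub_eq_zero.1 (norm_eq_zero.1 h5)
    have hRlip : ∀ y y' : V, ‖R y - R y'‖ ≤ η⁻¹ * ‖y - y'‖ := by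
      intro y y'
      have h1 := hT (hR y) (hR y')
      have h2 : y - η • R y - (y' - η • R y') = (y - y') - η • (R y - R y') := by
        rw [smul_sub]; abel
      rw [h2, inner_sub_left, real_inner_smul_left, real_inner_self_eq_norm_sq] at h1
      have h3 := real_inner_le_norm (y - y') (R y - R y')
      rw [inv_mul_eq_div, le_div_iff₀ hη]
      by_contra! h4
      have h5 : 0 < ‖R y - R y'‖ := by
        by_contra! h6
        nlinarith [norm_nonneg (y - y'), mul_nonneg (neg_nonneg.2 h6) hη.le]
      nlinarith [mul_lt_mul_of_pos_right h4 h5]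
    have hRc : Continuous R := by
      have : LipschitzWith (Real.toNNReal η⁻¹) R := LipschitzWith.of_dist_le_mul fun y y' => by
        rw [dist_eq_norm, dist_eq_norm, Real.coe_toNNReal _ (inv_pos.2 hη).le]
        exact hRlip y y'
      exact this.continuous
    -- R ∘ γ joins the zero w (t = 0) to z (t = 1), so some point on it has distance exactly r from
    -- Λ; the error bound applies there, to a value close to tg with t ≤ 1.
    let γ : ℝ → V := fun t => t • g + η • ((1 - t) • w + t • z)
    have hγ : Continuous γ := by fun_prop
    have hφ : Continuous fun t => Metric.infDist (R (γ t)) Λ :=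
      (Metric.continuous_infDist_pt Λ).comp (hRc.comp hγ)
    have e0 : R (γ 0) = w := hRinj (by simpa [γ] using hw0)
    have e1 : R (γ 1) = z := hRinj (by simpa [γ] using hg)
    obtain ⟨t, ⟨ht0, ht1⟩, ht⟩ := intermediate_value_Icc (zero_le_one' ℝ) hφ.continuousOn
      (show r ∈ Set.Icc _ _ by
        simp only [e0, e1]
        exact ⟨by rw [Metric.infDist_zero_of_mem hw]; exact hr, hz⟩)
    have hh := hR (γ t)
    have hb := hEB _ _ ht hh
    have hsq := norm_sub_smul_sq_le_of_regularized hT hη ht0 ht1 hw0 hg hh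
      (by simp only [γ, smul_sub]; abel)
    set h := γ t - η • R (γ t)
    have h1 : ‖h - t • g‖ ≤ √(η * |inner ℝ g (z - w)|) := by
      refine Real.le_sqrt_of_sq_le (hsq.trans ?_)
      refine mul_le_mul_of_nonneg_left ?_ hη.le
      have h2 : t * (1 - t) ≤ 1 := by nlinarith
      have h3 : 0 ≤ t * (1 - t) := mul_nonneg ht0 (by linarith)
      calc t * (1 - t) * inner ℝ g (z - w) ≤ t * (1 - t) * |inner ℝ g (z - w)| :=
            mul_le_mul_of_nonneg_left (le_abs_self _) h3
        _ ≤ 1 * |inner ℝ g (z - w)| := mul_le_mul_of_nonneg_right h2 (abs_nonneg _)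
        _ = _ := one_mul _
    have h2 : ‖h‖ ≤ ‖t • g‖ + ‖h - t • g‖ := norm_le_norm_add_norm_sub' h (t • g)
    have h3 : ‖t • g‖ ≤ ‖g‖ := by
      rw [norm_smul, Real.norm_eq_abs, abs_of_nonneg ht0]
      exact mul_le_of_le_one_left (norm_nonneg _) ht1
    exact hb.trans (mul_le_mul_of_nonneg_left (by linarith) hκ.le)
  have hlim : Tendsto (fun η : ℝ => κ * (‖g‖ + √(η * |inner ℝ g (z - w)|))) (𝓝[>] 0)
      (𝓝 (κ * (‖g‖ + √(0 * |inner ℝ g (z - w)|)))) := by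
    refine Tendsto.mono_left (Continuous.tendsto ?_ 0) nhdsWithin_le_nhds
    fun_prop
  rw [zero_mul, Real.sqrt_zero, add_zero] at hlim
  exact ge_of_tendsto hlim (by filter_upwards [self_mem_nhdsWithin] with η hη using main η hη)

end Monotone

/-! ### The inexact preconditioned proximal point method -/

section ProximalPoint

variable {V W : Type*} [NormedAddCommGroup V] [InnerProductSpace ℝ V]
  [NormedAddCommGroup W] [InnerProductSpace ℝ W] {T : V → Set V}
  {L : V →ₗ[ℝ] W} {S : V →ₗ[ℝ] V}

/-- Monotonicity against the zero w says that a - b and b - w have nonnegative inner product in the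
weighted geometry; expand the square of their sum. -/
theorem fejer_step (hT : IsMonotoneOp T) (hS : ∀ a b, inner ℝ a (S b) = inner ℝ (L a) (L b))
    {σ : ℝ} (hσ : 0 < σ) {a b w : V} (hb : σ⁻¹ • S (a - b) ∈ T b) (hw : 0 ∈ T w) :
    ‖L (b - w)‖ ^ 2 + ‖L (a - b)‖ ^ 2 ≤ ‖L (a - w)‖ ^ 2 := by
  have h := hT hb hw
  rw [sub_zero, real_inner_smul_left, real_inner_comm, hS] at h
  have h1 : 0 ≤ inner ℝ (L (b - w)) (L (a - b)) :=
    nonneg_of_mul_nonneg_right h (inv_pos.2 hσ)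
  have h2 : L (a - w) = L (b - w) + L (a - b) := by rw [← map_add]; congr 1; abel
  rw [h2, norm_add_sq_real]
  linarith

/-- Here S = LᵀL, so ‖Sa‖² = ⟨L(Sa), La⟩; apply Cauchy–Schwarz and the bound on L at Sa. -/
theorem norm_apply_le_of_sq_le (hS : ∀ a b, inner ℝ a (S b) = inner ℝ (L a) (L b)) {M : ℝ}
    (hM : ∀ a, ‖L a‖ ^ 2 ≤ M * ‖a‖ ^ 2) (a : V) : ‖S a‖ ≤ √M * ‖L a‖ := by
  have h1 : ‖S a‖ ^ 2 ≤ ‖L (S a)‖ * ‖L a‖ := by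
    rw [← real_inner_self_eq_norm_sq, hS]
    exact real_inner_le_norm _ _
  have h2 : ‖L (S a)‖ ≤ √M * ‖S a‖ := by
    rcases eq_or_ne (S a) 0 with h | h
    · simp [h]
    · have hM0 : 0 ≤ M := by
        have := (sq_nonneg _).trans (hM (S a))
        exact nonneg_of_mul_nonneg_left this (by positivity)
      refine le_of_sq_le_sq ?_ (by positivity)
      rw [mul_pow, Real.sq_sqrt hM0]
      exact hM _
  rcases eq_or_ne (S a) 0 with h | h
  · rw [h, norm_zero]; positivity
  · have h3 : 0 < ‖S a‖ := norm_pos_iff.2 h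
    have h4 := mul_le_mul_of_nonneg_right h2 (norm_nonneg (L a))
    by_contra! h5
    nlinarith [mul_lt_mul_of_pos_right h5 h3]

/-- Cauchy–Schwarz in ‖La‖² = ⟨a, Sa⟩ and √m‖a‖ ≤ ‖La‖. For m ≤ 0 the root is 0 by convention. -/
theorem sqrt_mul_norm_le (hS : ∀ a b, inner ℝ a (S b) = inner ℝ (L a) (L b)) {m : ℝ}
    (hm : ∀ a, m * ‖a‖ ^ 2 ≤ ‖L a‖ ^ 2) (a : V) : √m * ‖L a‖ ≤ ‖S a‖ := by
  rcases le_or_gt m 0 with h | h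
  · rw [Real.sqrt_eq_zero_of_nonpos h, zero_mul]; exact norm_nonneg _
  have h1 : ‖L a‖ ^ 2 ≤ ‖a‖ * ‖S a‖ := by
    rw [← real_inner_self_eq_norm_sq, ← hS]
    exact real_inner_le_norm _ _
  have h2 : √m * ‖a‖ ≤ ‖L a‖ := by
    refine le_of_sq_le_sq ?_ (norm_nonneg _)
    rw [mul_pow, Real.sq_sqrt h.le]
    exact hm a
  rcases eq_or_ne (L a) 0 with h0 | h0
  · rw [h0, norm_zero, mul_zero]; exact norm_nonneg _
  · have h3 : 0 < ‖L a‖ := norm_pos_iff.2 h0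
    have h4 := mul_le_mul_of_nonneg_right h2 (norm_nonneg (S a))
    have h5 := mul_le_mul_of_nonneg_left h1 (Real.sqrt_nonneg m)
    by_contra! h6
    nlinarith [mul_lt_mul_of_pos_right h6 h3]

/-- The size in the weighted norm of the displacement that absorbs an error term `e`. -/
theorem norm_displacement_le (hS : ∀ a b, inner ℝ a (S b) = inner ℝ (L a) (L b)) {m : ℝ}
    (hm : ∀ a, m * ‖a‖ ^ 2 ≤ ‖L a‖ ^ 2) (hSinj : Function.Injective S) {σ t : ℝ} (hσ : 0 < σ)
    {e a : V} (he : ‖e‖ ≤ √m / σ * t) (ha : S a = σ • e) (ht : 0 ≤ t) : ‖L a‖ ≤ t := by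
  have h1 := sqrt_mul_norm_le hS hm a
  have h2 : ‖S a‖ ≤ √m * t := by
    rw [ha, norm_smul, Real.norm_eq_abs, abs_of_pos hσ]
    calc σ * ‖e‖ ≤ σ * (√m / σ * t) := mul_le_mul_of_nonneg_left he hσ.le
      _ = √m * t := by field_simp
  -- The case √m = 0 does occur, since `eigMin` of an empty matrix is `sInf ∅ = 0`. The bound then
  -- forces Sa = 0, hence a = 0.
  rcases (Real.sqrt_nonneg m).eq_or_lt with h | h
  · rw [← h, zero_mul] at h2
    have h3 : S a = S 0 := by rw [map_zero]; exact norm_le_zero_iff.1 h2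
    rw [hSinj h3, map_zero, norm_zero]; exact ht
  · exact le_of_mul_le_mul_left (h1.trans h2) h

/-- An inexact preconditioned proximal point iteration
`σ⁻¹ S (a k - z (k + 1)) ∈ T (z (k + 1))`, where `a k` is within `ε k` of `z k` in the weighted norm. -/
structure IsInexactPPA (T : V → Set V) (L : V →ₗ[ℝ] W) (S : V →ₗ[ℝ] V) (σ ε : ℕ → ℝ)
    (z a : ℕ → V) : Prop where
  step : ∀ k, (σ k)⁻¹ • S (a k - z (k + 1)) ∈ T (z (k + 1))
  close : ∀ k, ‖L (a k - z k)‖ ≤ ε k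

namespace IsInexactPPA

variable {σ ε : ℕ → ℝ} {z a : ℕ → V}

theorem norm_inexact_le (h : IsInexactPPA T L S σ ε z a) (w : V) (k : ℕ) :
    ‖L (a k - w)‖ ≤ ‖L (z k - w)‖ + ε k := by
  have h1 : L (a k - w) = L (a k - z k) + L (z k - w) := by rw [← map_add]; congr 1; abel
  rw [h1]
  linarith [norm_add_le (L (a k - z k)) (L (z k - w)), h.close k]

theorem norm_succ_le (h : IsInexactPPA T L S σ ε z a) (hT : IsMonotoneOp T)
    (hS : ∀ a b, inner ℝ a (S b) = inner ℝ (L a) (L b)) (hσ : ∀ k, 0 < σ k) {w : V}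
    (hw : 0 ∈ T w) (k : ℕ) : ‖L (z (k + 1) - w)‖ ≤ ‖L (z k - w)‖ + ε k := by
  refine le_trans (le_of_sq_le_sq ?_ (norm_nonneg _)) (h.norm_inexact_le w k)
  have := fejer_step hT hS (hσ k) (h.step k) hw
  nlinarith [sq_nonneg ‖L (a k - z (k + 1))‖]

theorem norm_le_add_sum (h : IsInexactPPA T L S σ ε z a) (hT : IsMonotoneOp T)
    (hS : ∀ a b, inner ℝ a (S b) = inner ℝ (L a) (L b)) (hσ : ∀ k, 0 < σ k) {w : V}
    (hw : 0 ∈ T w) (k : ℕ) : ‖L (z k - w)‖ ≤ ‖L (z 0 - w)‖ + ∑ j ∈ Finset.range k, ε j := by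
  induction k with
  | zero => simp
  | succ k ih =>
    rw [Finset.sum_range_succ]
    linarith [h.norm_succ_le hT hS hσ hw k]

theorem norm_le_add_tsum (h : IsInexactPPA T L S σ ε z a) (hT : IsMonotoneOp T)
    (hS : ∀ a b, inner ℝ a (S b) = inner ℝ (L a) (L b)) (hσ : ∀ k, 0 < σ k)
    (hε : ∀ k, 0 ≤ ε k) (hεs : Summable ε) {w : V}
    (hw : 0 ∈ T w) (k : ℕ) : ‖L (z k - w)‖ ≤ (∑' j, ε j) + ‖L (z 0 - w)‖ := by
  have := h.norm_le_add_sum hT hS hσ hw k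
  have := hεs.sum_le_tsum (Finset.range k) fun j _ => hε j
  linarith

/-- The distances grow by at most εₖ per step, so subtracting the partial sums of ε leaves an
antitone sequence bounded below. -/
theorem exists_tendsto_norm (h : IsInexactPPA T L S σ ε z a) (hT : IsMonotoneOp T)
    (hS : ∀ a b, inner ℝ a (S b) = inner ℝ (L a) (L b)) (hσ : ∀ k, 0 < σ k)
    (hε : ∀ k, 0 ≤ ε k) (hεs : Summable ε) {w : V} (hw : 0 ∈ T w) :
    ∃ l, Tendsto (fun k => ‖L (z k - w)‖) atTop (𝓝 l) := by
  have hanti : Antitone fun k => ‖L (z k - w)‖ - ∑ j ∈ Finset.range k, ε j := by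
    refine antitone_nat_of_succ_le fun k => ?_
    rw [Finset.sum_range_succ]
    linarith [h.norm_succ_le hT hS hσ hw k]
  have hbdd : BddBelow (Set.range fun k => ‖L (z k - w)‖ - ∑ j ∈ Finset.range k, ε j) := by
    refine ⟨-∑' j, ε j, ?_⟩
    rintro _ ⟨k, rfl⟩
    have := hεs.sum_le_tsum (Finset.range k) fun j _ => hε j
    simp only
    linarith [norm_nonneg (L (z k - w))]
  refine ⟨_, ((tendsto_atTop_ciInf hanti hbdd).add hεs.hasSum.tendsto_sum_nat).congr fun k => ?_⟩
  ring

/-- The squared step is the slack in `fejer_step`, dominated by a difference of two quantities with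
the same limit. -/
theorem tendsto_norm_step (h : IsInexactPPA T L S σ ε z a) (hT : IsMonotoneOp T)
    (hS : ∀ a b, inner ℝ a (S b) = inner ℝ (L a) (L b)) (hσ : ∀ k, 0 < σ k)
    (hε : ∀ k, 0 ≤ ε k) (hεs : Summable ε) {w : V} (hw : 0 ∈ T w) :
    Tendsto (fun k => ‖L (a k - z (k + 1))‖) atTop (𝓝 0) := by
  obtain ⟨l, hl⟩ := h.exists_tendsto_norm hT hS hσ hε hεs hw
  have h1 : Tendsto (fun k => (‖L (z k - w)‖ + ε k) ^ 2 - ‖L (z (k + 1) - w)‖ ^ 2) atTop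
      (𝓝 ((l + 0) ^ 2 - l ^ 2)) :=
    ((hl.add hεs.tendsto_atTop_zero).pow 2).sub (((tendsto_add_atTop_iff_nat 1).2 hl).pow 2)
  rw [add_zero, sub_self] at h1
  have h2 : Tendsto (fun k => ‖L (a k - z (k + 1))‖ ^ 2) atTop (𝓝 0) := by
    refine squeeze_zero (fun k => sq_nonneg _) (fun k => ?_) h1
    have h3 := fejer_step hT hS (hσ k) (h.step k) hw
    have h4 := pow_le_pow_left₀ (norm_nonneg _) (h.norm_inexact_le w k) 2
    linarith
  have := h2.sqrt
  simpa [Real.sqrt_sq (norm_nonneg _)] using this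

/-- Convergence of the inexact proximal point method in finite dimension. -/
theorem exists_tendsto [FiniteDimensional ℝ V] (h : IsInexactPPA T L S σ ε z a)
    (hT : IsMonotoneOp T)
    (hclosed : ∀ (x g : ℕ → V) (x₀ g₀ : V), (∀ k, g k ∈ T (x k)) → Tendsto x atTop (𝓝 x₀) →
      Tendsto g atTop (𝓝 g₀) → g₀ ∈ T x₀)
    (hS : ∀ a b, inner ℝ a (S b) = inner ℝ (L a) (L b)) (hL : Function.Injective L)
    {M : ℝ} (hM : ∀ a, ‖L a‖ ^ 2 ≤ M * ‖a‖ ^ 2)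
    (hσ0 : 0 < σ 0) (hσm : Monotone σ) (hε : ∀ k, 0 ≤ ε k) (hεs : Summable ε)
    (hne : ∃ w, 0 ∈ T w) :
    ∃ w, 0 ∈ T w ∧ Tendsto z atTop (𝓝 w) := by
  have hσ : ∀ k, 0 < σ k := fun k => hσ0.trans_le (hσm (Nat.zero_le k))
  obtain ⟨K, hK0, hK⟩ := L.exists_antilipschitzWith (LinearMap.ker_eq_bot.2 hL)
  have hKn : ∀ v, ‖v‖ ≤ K * ‖L v‖ := fun v => by
    simpa [dist_eq_norm] using hK.le_mul_dist v 0
  obtain ⟨w, hw⟩ := hne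
  have hbd : ∀ k, z k ∈ Metric.closedBall w (K * ((∑' j, ε j) + ‖L (z 0 - w)‖)) := fun k => by
    rw [mem_closedBall_iff_norm]
    exact (hKn _).trans
      (mul_le_mul_of_nonneg_left (h.norm_le_add_tsum hT hS hσ hε hεs hw k) K.2)
  have : ProperSpace V := FiniteDimensional.proper ℝ V
  obtain ⟨x, -, φ, hφ, hx⟩ := (isCompact_closedBall w _).tendsto_subseq
    (fun k => hbd (k + 1))
  -- Since σₖ ≥ σ₀ > 0, vanishing steps make the operator values vanish.
  have hg : Tendsto (fun k => (σ k)⁻¹ • S (a k - z (k + 1))) atTop (𝓝 0) := by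
    have h1 := h.tendsto_norm_step hT hS hσ hε hεs hw
    refine squeeze_zero_norm (fun k => ?_)
      (by have := h1.const_mul ((σ 0)⁻¹ * √M); rwa [mul_zero] at this)
    rw [norm_smul, Real.norm_eq_abs, abs_of_pos (inv_pos.2 (hσ k)), mul_assoc]
    exact mul_le_mul (inv_anti₀ hσ0 (hσm (Nat.zero_le k))) (norm_apply_le_of_sq_le hS hM _)
      (norm_nonneg _) (inv_pos.2 hσ0).le
  have hx0 : 0 ∈ T x := hclosed _ _ _ _ (fun k => h.step (φ k)) hx (hg.comp hφ.tendsto_atTop)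
  refine ⟨x, hx0, ?_⟩
  -- The distance to the cluster point x converges along the whole sequence, and to 0 along a
  -- subsequence.
  obtain ⟨l, hl⟩ := h.exists_tendsto_norm hT hS hσ hε hεs hx0
  have hLc : Continuous L := L.continuous_of_finiteDimensional
  have h1 : Tendsto (fun k => ‖L (z (φ k + 1) - x)‖) atTop (𝓝 0) := by
    have := ((hLc.tendsto _).comp (hx.sub_const x)).norm
    simpa using this
  have h2 : l = 0 := tendsto_nhds_unique
    (hl.comp ((tendsto_add_atTop_nat 1).comp hφ.tendsto_atTop)) h1
  rw [tendsto_iff_norm_sub_tendsto_zero]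
  refine squeeze_zero (fun k => norm_nonneg _) (fun k => hKn _) ?_
  rw [h2] at hl
  simpa using hl.const_mul (K : ℝ)

end IsInexactPPA

/-- The contraction estimate of one inexact proximal point step. -/
theorem dist_step_le_mu_mul (hT : IsMonotoneOp T)
    (hS : ∀ a b, inner ℝ a (S b) = inner ℝ (L a) (L b)) {M : ℝ} (hM1 : 1 ≤ M)
    (hM : ∀ a, ‖L a‖ ^ 2 ≤ M * ‖a‖ ^ 2) {σ κ δ : ℝ} (hσ : 0 < σ) (hκ : 0 < κ)
    (hδ0 : 0 ≤ δ) (hδ1 : δ < 1) {a b z : V} (hb : σ⁻¹ • S (a - b) ∈ T b)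
    (haz : ‖L (a - z)‖ ≤ δ * ‖L (b - z)‖) {ρ ρ' : ℝ} (hρ' : 0 ≤ ρ')
    (hle : ∀ w, 0 ∈ T w → ρ' ≤ ‖L (b - w)‖)
    (hlt : ∀ t, ρ < t → ∃ w, 0 ∈ T w ∧ ‖L (z - w)‖ < t)
    (hEB : ρ' ≤ √M * (κ * ‖σ⁻¹ • S (a - b)‖)) :
    ρ' ≤ mu κ M σ δ * ρ := by
  have hs : 0 < √(σ ^ 2 + κ ^ 2 * M ^ 2) := by positivity
  -- A nearly closest zero w suffices: prove the bound for every t > ρ and let t decrease to ρ.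
  have key : ∀ t, ρ < t → ρ' ≤ mu κ M σ δ * t := by
    intro t ht
    obtain ⟨w, hw, hwt⟩ := hlt t ht
    have hf := fejer_step hT hS hσ hb hw
    have e1 : ‖L (a - w)‖ ≤ ‖L (a - z)‖ + ‖L (z - w)‖ := by
      have : L (a - w) = L (a - z) + L (z - w) := by rw [← map_add]; congr 1; abel
      rw [this]; exact norm_add_le _ _
    have e2 : ‖L (b - z)‖ ≤ ‖L (b - w)‖ + ‖L (z - w)‖ := by
      have : L (b - z) = L (b - w) - L (z - w) := by rw [← map_sub]; congr 1; abel
      rw [this]; exact norm_sub_le _ _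
    have e3 : ‖L (b - w)‖ ≤ ‖L (a - w)‖ :=
      le_of_sq_le_sq (by nlinarith [sq_nonneg ‖L (a - b)‖]) (norm_nonneg _)
    have hδ' : 0 < 1 - δ := by linarith
    -- ‖b - z‖ ≤ ‖a - w‖ + t ≤ δ‖b - z‖ + 2t in the weighted norm; feeding this into ‖a - w‖ ≤ δ‖b -
    -- z‖ + t gives `e5`.
    have e4 : ‖L (b - z)‖ * (1 - δ) ≤ 2 * t := by nlinarith
    have e5 : ‖L (a - w)‖ * (1 - δ) ≤ (1 + δ) * t := by
      nlinarith [mul_le_mul_of_nonneg_left e4 hδ0]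
    -- One factor √M comes from the weighted error bound, the other from passing from S to L.
    have e6 : σ * ρ' ≤ κ * M * ‖L (a - b)‖ := by
      have h1 := norm_apply_le_of_sq_le hS hM (a - b)
      rw [norm_smul, Real.norm_eq_abs, abs_of_pos (inv_pos.2 hσ)] at hEB
      calc σ * ρ' ≤ σ * (√M * (κ * (σ⁻¹ * ‖S (a - b)‖))) := mul_le_mul_of_nonneg_left hEB hσ.le
        _ = κ * √M * ‖S (a - b)‖ := by field_simp
        _ ≤ κ * √M * (√M * ‖L (a - b)‖) := by gcongr
        _ = κ * (√M * √M) * ‖L (a - b)‖ := by ring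
        _ = κ * M * ‖L (a - b)‖ := by rw [Real.mul_self_sqrt (by linarith)]
    -- Eliminate ‖L(a - b)‖ between `e6` and ρ'² + ‖L(a - b)‖² ≤ ‖L(a - w)‖².
    have e7 : ρ' * √(σ ^ 2 + κ ^ 2 * M ^ 2) ≤ κ * M * ‖L (a - w)‖ := by
      refine le_of_sq_le_sq ?_ (by positivity)
      rw [mul_pow, Real.sq_sqrt (by positivity)]
      have h1 := pow_le_pow_left₀ (by positivity) e6 2
      have h2 := pow_le_pow_left₀ hρ' (hle w hw) 2
      have h3 : ρ' ^ 2 + ‖L (a - b)‖ ^ 2 ≤ ‖L (a - w)‖ ^ 2 := by linarith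
      have h4 := mul_le_mul_of_nonneg_left h3 (by positivity : 0 ≤ (κ * M) ^ 2)
      nlinarith
    have ht0 : 0 ≤ t := (norm_nonneg _).trans hwt.le
    have e8 : ρ' ≤ (1 + δ) * κ * M / √(σ ^ 2 + κ ^ 2 * M ^ 2) / (1 - δ) * t := by
      rw [div_div, div_mul_eq_mul_div, le_div_iff₀ (by positivity), ← mul_assoc]
      calc ρ' * √(σ ^ 2 + κ ^ 2 * M ^ 2) * (1 - δ) ≤ κ * M * ‖L (a - w)‖ * (1 - δ) :=
            mul_le_mul_of_nonneg_right e7 hδ'.le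
        _ = κ * M * (‖L (a - w)‖ * (1 - δ)) := by ring
        _ ≤ κ * M * ((1 + δ) * t) := by gcongr
        _ = _ := by ring
    -- The factor in `e8` is `mu` without its nonnegative summand δ/(1 - δ).
    refine e8.trans (mul_le_mul_of_nonneg_right ?_ ht0)
    rw [mu, one_div, inv_mul_eq_div]
    gcongr
    linarith
  have hlim : Tendsto (fun t => mu κ M σ δ * t) (𝓝[>] ρ) (𝓝 (mu κ M σ δ * ρ)) :=
    Tendsto.mono_left (Continuous.tendsto (by fun_prop) ρ) nhdsWithin_le_nhds
  exact ge_of_tendsto hlim (by filter_upwards [self_mem_nhdsWithin] with t ht using key t ht)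

end ProximalPoint

/-! ### Spectral bounds for the weight matrices. -/

section Weights

variable {ι : Type*} [Fintype ι] [DecidableEq ι] {H : Matrix ι ι ℝ}

theorem inner_act_transpose {κ : Type*} [Fintype κ] [DecidableEq κ] (M : Matrix ι κ ℝ)
    (x : EuclideanSpace ℝ κ) (y : EuclideanSpace ℝ ι) :
    inner ℝ x (act M.transpose y) = inner ℝ (act M x) y := by
  rw [act, ← Matrix.conjTranspose_eq_transpose_of_trivial,
    Matrix.toEuclideanLin_conjTranspose_eq_adjoint, LinearMap.adjoint_inner_right]

theorem inner_act_comm (hH : H.IsHermitian) (x y : EuclideanSpace ℝ ι) :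
    inner ℝ x (act H y) = inner ℝ (act H x) y := by
  rw [← inner_act_transpose, ← Matrix.conjTranspose_eq_transpose_of_trivial, hH.eq]

theorem inner_act_eq_sum (hH : H.IsHermitian) (x y : EuclideanSpace ℝ ι) :
    inner ℝ x (act H y) = ∑ i, hH.eigenvalues i *
      (hH.eigenvectorBasis.repr x i * hH.eigenvectorBasis.repr y i) := by
  have hb : ∀ i, act H (hH.eigenvectorBasis i) = hH.eigenvalues i • hH.eigenvectorBasis i := by
    intro i
    ext j
    exact congrFun (hH.mulVec_eigenvectorBasis i) j
  have hr : ∀ i, hH.eigenvectorBasis.repr (act H y) i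
      = hH.eigenvalues i * hH.eigenvectorBasis.repr y i := by
    intro i
    rw [OrthonormalBasis.repr_apply_apply, inner_act_comm hH, hb, real_inner_smul_left,
      OrthonormalBasis.repr_apply_apply]
  rw [← hH.eigenvectorBasis.repr.inner_map_map, PiLp.inner_apply]
  refine Finset.sum_congr rfl fun i _ => ?_
  rw [hr]
  simp only [RCLike.inner_apply, conj_trivial]
  ring

/-- The weighted eigenvector coordinates `√λᵢ ⟨bᵢ, x⟩`, whose Euclidean norm is `‖x‖_H`. -/
def sqrtCoord (hH : H.IsHermitian) : EuclideanSpace ℝ ι →ₗ[ℝ] EuclideanSpace ℝ ι :=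
  (Matrix.toEuclideanLin (Matrix.diagonal fun i => √(hH.eigenvalues i))).comp
    hH.eigenvectorBasis.repr.toLinearEquiv.toLinearMap

theorem sqrtCoord_apply (hH : H.IsHermitian) (x : EuclideanSpace ℝ ι) (i : ι) :
    sqrtCoord hH x i = √(hH.eigenvalues i) * hH.eigenvectorBasis.repr x i := by
  simp [sqrtCoord, Matrix.toLpLin_apply, Matrix.mulVec_diagonal]

theorem inner_sqrtCoord (hH : H.PosDef) (x y : EuclideanSpace ℝ ι) :
    inner ℝ x (act H y) = inner ℝ (sqrtCoord hH.1 x) (sqrtCoord hH.1 y) := by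
  rw [inner_act_eq_sum hH.1, PiLp.inner_apply]
  refine Finset.sum_congr rfl fun i _ => ?_
  simp only [RCLike.inner_apply, conj_trivial, sqrtCoord_apply]
  nth_rewrite 1 [← Real.mul_self_sqrt (hH.eigenvalues_pos i).le]
  ring

theorem norm_sq_eq_sum_repr (hH : H.IsHermitian) (x : EuclideanSpace ℝ ι) :
    ‖x‖ ^ 2 = ∑ i, hH.eigenvectorBasis.repr x i * hH.eigenvectorBasis.repr x i := by
  rw [← hH.eigenvectorBasis.repr.norm_map, EuclideanSpace.norm_sq_eq]
  refine Finset.sum_congr rfl fun i _ => ?_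
  rw [Real.norm_eq_abs, sq_abs, sq]

/-- In eigenvector coordinates the form is a weighted sum of squares; finiteness of the spectrum
makes `sInf` a genuine lower bound. -/
theorem eigMin_mul_le (hH : H.IsHermitian) (x : EuclideanSpace ℝ ι) :
    eigMin H * ‖x‖ ^ 2 ≤ inner ℝ x (act H x) := by
  rw [inner_act_eq_sum hH, norm_sq_eq_sum_repr hH, Finset.mul_sum]
  refine Finset.sum_le_sum fun i _ => mul_le_mul_of_nonneg_right ?_ (mul_self_nonneg _)
  exact csInf_le Matrix.finite_real_spectrum.bddBelow (hH.eigenvalues_mem_spectrum_real i)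

theorem le_eigMax_mul (hH : H.IsHermitian) (x : EuclideanSpace ℝ ι) :
    inner ℝ x (act H x) ≤ eigMax H * ‖x‖ ^ 2 := by
  rw [inner_act_eq_sum hH, norm_sq_eq_sum_repr hH, Finset.mul_sum]
  refine Finset.sum_le_sum fun i _ => mul_le_mul_of_nonneg_right ?_ (mul_self_nonneg _)
  exact le_csSup Matrix.finite_real_spectrum.bddAbove (hH.eigenvalues_mem_spectrum_real i)

theorem sqrtCoord_injective (hH : H.PosDef) : Function.Injective (sqrtCoord hH.1) := by
  intro x y hxy
  refine hH.1.eigenvectorBasis.repr.injective ?_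
  ext i
  have h := congrArg (fun v => v i) hxy
  simp only [sqrtCoord_apply] at h
  exact mul_left_cancel₀ (Real.sqrt_pos.2 (hH.eigenvalues_pos i)).ne' h

theorem wnorm_sq (hH : H.PosDef) (x : EuclideanSpace ℝ ι) :
    wnorm H x ^ 2 = inner ℝ x (act H x) := by
  rw [wnorm, Real.sq_sqrt]
  rw [inner_sqrtCoord hH]
  exact real_inner_self_nonneg

end Weights

/-! ### The operator Σ on the primal-dual space. -/

section Sigma

variable {n d : ℕ} {H₁ : Matrix (Fin n) (Fin n) ℝ} {H₂ : Matrix (Fin n × Fin d) (Fin n × Fin d) ℝ}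

theorem inner_PD (z w : PD n d) : inner ℝ z w = inner ℝ z.fst.fst w.fst.fst
    + inner ℝ z.fst.snd w.fst.snd + inner ℝ z.snd.fst w.snd.fst + inner ℝ z.snd.snd w.snd.snd := by
  rw [WithLp.prod_inner_apply, WithLp.prod_inner_apply, WithLp.prod_inner_apply, ← add_assoc]
  rfl

theorem norm_sq_PD (z : PD n d) : ‖z‖ ^ 2 = ‖z.fst.fst‖ ^ 2 + ‖z.fst.snd‖ ^ 2
    + ‖z.snd.fst‖ ^ 2 + ‖z.snd.snd‖ ^ 2 := by
  rw [WithLp.prod_norm_sq_eq_of_L2, WithLp.prod_norm_sq_eq_of_L2, WithLp.prod_norm_sq_eq_of_L2,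
    ← add_assoc]

/-- The operator `Diag(M₁, M₂, I, I)`. -/
def diagOp (M₁ : ThetaSp n →ₗ[ℝ] ThetaSp n) (M₂ : XiSp n d →ₗ[ℝ] XiSp n d) :
    PD n d →ₗ[ℝ] PD n d where
  toFun z := WithLp.toLp 2 (WithLp.toLp 2 (M₁ z.fst.fst, M₂ z.fst.snd), z.snd)
  map_add' z w := by simp only [WithLp.add_fst, WithLp.add_snd, map_add]; rfl
  map_smul' c z := by
    simp only [WithLp.smul_fst, WithLp.smul_snd, map_smul, RingHom.id_apply]; rfl

/-- `Σ = Diag(H₁, H₂, I, I)`. -/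
def sigOp (H₁ : Matrix (Fin n) (Fin n) ℝ) (H₂ : Matrix (Fin n × Fin d) (Fin n × Fin d) ℝ) :
    PD n d →ₗ[ℝ] PD n d :=
  diagOp (Matrix.toEuclideanLin H₁) (Matrix.toEuclideanLin H₂)

/-- A linear map `R` with `RᵀR = Σ`. -/
def sqrtOp (hH₁ : H₁.PosDef) (hH₂ : H₂.PosDef) : PD n d →ₗ[ℝ] PD n d :=
  diagOp (sqrtCoord hH₁.1) (sqrtCoord hH₂.1)

theorem inner_sigOp (hH₁ : H₁.PosDef) (hH₂ : H₂.PosDef) (a b : PD n d) :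
    inner ℝ a (sigOp H₁ H₂ b) = inner ℝ (sqrtOp hH₁ hH₂ a) (sqrtOp hH₁ hH₂ b) := by
  rw [inner_PD, inner_PD]
  have h₁ := inner_sqrtCoord hH₁ a.fst.fst b.fst.fst
  have h₂ := inner_sqrtCoord hH₂ a.fst.snd b.fst.snd
  exact congrArg₂ (· + ·) (congrArg₂ (· + ·) (congrArg₂ (· + ·) h₁ h₂) rfl) rfl

theorem norm_sqrtOp_sq (hH₁ : H₁.PosDef) (hH₂ : H₂.PosDef) (z : PD n d) :
    ‖sqrtOp hH₁ hH₂ z‖ ^ 2 = inner ℝ z.fst.fst (act H₁ z.fst.fst)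
      + inner ℝ z.fst.snd (act H₂ z.fst.snd) + ‖z.snd.fst‖ ^ 2 + ‖z.snd.snd‖ ^ 2 := by
  rw [norm_sq_PD, inner_sqrtCoord hH₁, inner_sqrtCoord hH₂, real_inner_self_eq_norm_sq,
    real_inner_self_eq_norm_sq]
  rfl

theorem normSig_eq (hH₁ : H₁.PosDef) (hH₂ : H₂.PosDef) (z : PD n d) :
    normSig H₁ H₂ z = ‖sqrtOp hH₁ hH₂ z‖ := by
  rw [normSig, ← norm_sqrtOp_sq hH₁ hH₂, Real.sqrt_sq (norm_nonneg _)]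

theorem sqrtOp_injective (hH₁ : H₁.PosDef) (hH₂ : H₂.PosDef) :
    Function.Injective (sqrtOp hH₁ hH₂) := by
  intro z w h
  have h1 : sqrtCoord hH₁.1 z.fst.fst = sqrtCoord hH₁.1 w.fst.fst :=
    congrArg (fun z : PD n d => z.fst.fst) h
  have h2 : sqrtCoord hH₂.1 z.fst.snd = sqrtCoord hH₂.1 w.fst.snd :=
    congrArg (fun z : PD n d => z.fst.snd) h
  have h3 : (sqrtOp hH₁ hH₂ z).snd = (sqrtOp hH₁ hH₂ w).snd :=
    congrArg (fun z : PD n d => z.snd) h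
  exact WithLp.ofLp_injective 2 (Prod.ext (WithLp.ofLp_injective 2
    (Prod.ext (sqrtCoord_injective hH₁ h1) (sqrtCoord_injective hH₂ h2))) h3)

theorem sigOp_injective (hH₁ : H₁.PosDef) (hH₂ : H₂.PosDef) :
    Function.Injective (sigOp H₁ H₂) := by
  rw [injective_iff_map_eq_zero]
  intro a ha
  have h := inner_sigOp hH₁ hH₂ a a
  rw [ha, inner_zero_right] at h
  exact (injective_iff_map_eq_zero _).1 (sqrtOp_injective hH₁ hH₂) a (inner_self_eq_zero.1 h.symm)

/-- Lets Σb = e be solved for the displacement b that absorbs a gradient error e. -/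
theorem sigOp_surjective (hH₁ : H₁.PosDef) (hH₂ : H₂.PosDef) :
    Function.Surjective (sigOp H₁ H₂) :=
  LinearMap.injective_iff_surjective.1 (sigOp_injective hH₁ hH₂)

theorem lamMin_mul_le (hH₁ : H₁.PosDef) (hH₂ : H₂.PosDef) (z : PD n d) :
    lamMin H₁ H₂ * ‖z‖ ^ 2 ≤ ‖sqrtOp hH₁ hH₂ z‖ ^ 2 := by
  rw [norm_sqrtOp_sq, norm_sq_PD, mul_add, mul_add, mul_add]
  have h1 : lamMin H₁ H₂ ≤ eigMin H₁ := min_le_left _ _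
  have h2 : lamMin H₁ H₂ ≤ eigMin H₂ := (min_le_right _ _).trans (min_le_left _ _)
  have h3 : lamMin H₁ H₂ ≤ 1 := (min_le_right _ _).trans (min_le_right _ _)
  have e1 := eigMin_mul_le hH₁.1 z.fst.fst
  have e2 := eigMin_mul_le hH₂.1 z.fst.snd
  have f1 := mul_le_mul_of_nonneg_right h1 (sq_nonneg ‖z.fst.fst‖)
  have f2 := mul_le_mul_of_nonneg_right h2 (sq_nonneg ‖z.fst.snd‖)
  have f3 := mul_le_mul_of_nonneg_right h3 (sq_nonneg ‖z.snd.fst‖)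
  have f4 := mul_le_mul_of_nonneg_right h3 (sq_nonneg ‖z.snd.snd‖)
  linarith

theorem le_lamMax_mul (hH₁ : H₁.PosDef) (hH₂ : H₂.PosDef) (z : PD n d) :
    ‖sqrtOp hH₁ hH₂ z‖ ^ 2 ≤ lamMax H₁ H₂ * ‖z‖ ^ 2 := by
  rw [norm_sqrtOp_sq, norm_sq_PD, mul_add, mul_add, mul_add]
  have h1 : eigMax H₁ ≤ lamMax H₁ H₂ := le_max_left _ _
  have h2 : eigMax H₂ ≤ lamMax H₁ H₂ := (le_max_left _ _).trans (le_max_right _ _)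
  have h3 : 1 ≤ lamMax H₁ H₂ := (le_max_right _ _).trans (le_max_right _ _)
  have e1 := le_eigMax_mul hH₁.1 z.fst.fst
  have e2 := le_eigMax_mul hH₂.1 z.fst.snd
  have f1 := mul_le_mul_of_nonneg_right h1 (sq_nonneg ‖z.fst.fst‖)
  have f2 := mul_le_mul_of_nonneg_right h2 (sq_nonneg ‖z.fst.snd‖)
  have f3 := mul_le_mul_of_nonneg_right h3 (sq_nonneg ‖z.snd.fst‖)
  have f4 := mul_le_mul_of_nonneg_right h3 (sq_nonneg ‖z.snd.snd‖)
  linarith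

theorem one_le_lamMax : 1 ≤ lamMax H₁ H₂ := (le_max_right _ _).trans (le_max_right _ _)

end Sigma

/-! ### The product set D × ⋯ × D and the orthant. -/

section Sets

variable {n d : ℕ} (P : Data n d)

/-- The domain `D × ⋯ × D` of `p`. -/
def Data.xiSet : Set (XiSp n d) := {ξ | ∀ i, block ξ i ∈ P.D}

theorem Data.p_eq_ind : P.p = ind P.xiSet := by
  funext ξ
  by_cases h : ξ ∈ P.xiSet
  · rw [ind_of_mem h, Data.p]
    exact Finset.sum_eq_zero fun i _ => ind_of_mem (h i)
  · rw [ind_of_notMem h, Data.p]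
    obtain ⟨i, hi⟩ := not_forall.1 h
    rw [← Finset.add_sum_erase _ _ (Finset.mem_univ i), ind_of_notMem hi]
    -- In `EReal`, ⊤ + ⊥ = ⊥, so the remaining summands must be kept away from ⊥.
    refine EReal.top_add_of_ne_bot (ne_bot_of_le_ne_bot EReal.zero_ne_bot
      (Finset.sum_nonneg fun j _ => ?_))
    rw [ind]
    split_ifs
    exacts [le_rfl, le_top]

variable {P}

theorem Data.xiSet_nonempty (h : P.D.Nonempty) : P.xiSet.Nonempty := by
  obtain ⟨x, hx⟩ := h
  exact ⟨WithLp.toLp 2 fun r => x r.2, fun i => hx⟩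

theorem Data.xiSet_isClosed (h : IsClosed P.D) : IsClosed P.xiSet := by
  rw [Data.xiSet, Set.ofPred_forall]
  refine isClosed_iInter fun i => h.preimage ?_
  unfold block
  fun_prop

theorem Data.xiSet_convex (h : Convex ℝ P.D) : Convex ℝ P.xiSet :=
  fun _ hx _ hy _ _ ha hb hab i => h (hx i) (hy i) ha hb hab

theorem orthant_nonempty : (orthant n).Nonempty := ⟨0, fun _ => le_rfl⟩

theorem orthant_isClosed : IsClosed (orthant n) := by
  rw [orthant, Set.ofPred_forall]
  exact isClosed_iInter fun i => isClosed_le continuous_const (by fun_prop)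

theorem orthant_convex : Convex ℝ (orthant n) := fun _ hx _ hy _ _ ha hb _ i =>
  add_nonneg (mul_nonneg ha (hx i)) (mul_nonneg hb (hy i))

/-- The orthant is self-dual. Writing δ₊ as a conjugate puts u and v on the same footing in the
Lagrangian. -/
theorem conj_ind_orthant (u : USp n) : conj (ind (orthant n)) (-u) = ind (orthant n) u := by
  by_cases hu : u ∈ orthant n
  · rw [ind_of_mem hu]
    refine le_antisymm (conj_ind_le fun q hq => ?_) ?_
    · have h : 0 ≤ inner ℝ q u := by
        rw [PiLp.inner_apply]
        exact Finset.sum_nonneg fun i _ => mul_nonneg (hu i) (hq i)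
      rw [inner_neg_right]
      exact_mod_cast neg_nonpos.2 h
    · simpa using inner_le_conj_ind (C := orthant n) (q := 0) (fun _ => le_rfl) (-u)
  · rw [ind_of_notMem hu]
    obtain ⟨i, hi⟩ := not_forall.1 hu
    rw [not_le] at hi
    refine EReal.eq_top_iff_forall_lt _ |>.2 fun y => ?_
    -- Along a coordinate with uᵢ < 0, this scaling makes the pairing with -u equal to |y| + 1 > y.
    have hq : EuclideanSpace.single i ((|y| + 1) / -u i) ∈ orthant n := by
      intro j
      have : 0 ≤ (|y| + 1) / -u i := div_nonneg (by positivity) (by linarith)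
      by_cases hij : j = i
      · subst hij; simpa using this
      · simp [hij]
    refine lt_of_lt_of_le ?_ (inner_le_conj_ind hq (-u))
    rw [EuclideanSpace.inner_single_left]
    have h2 : (|y| + 1) / -u i * -u i = |y| + 1 := div_mul_cancel₀ _ (by linarith)
    simp only [conj_trivial, PiLp.neg_apply, h2]
    exact_mod_cast (le_abs_self y).trans_lt (by linarith)

end Sets

/-! ### Monotonicity and closedness of normal cones. -/

section NormalCone

variable {E : Type*} [NormedAddCommGroup E] [InnerProductSpace ℝ E] {C : Set E}

theorem normalCone_monotone {q q' g g' : E} (h : g ∈ normalCone C q) (h' : g' ∈ normalCone C q') :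
    0 ≤ inner ℝ (g - g') (q - q') := by
  have h1 := h.2 _ h'.1
  have h2 := h'.2 _ h.1
  rw [← neg_sub q q', inner_neg_right] at h1
  rw [inner_sub_left]
  linarith

theorem normalCone_of_tendsto (hC : IsClosed C) {q g : ℕ → E} {q₀ g₀ : E}
    (h : ∀ k, g k ∈ normalCone C (q k)) (hq : Tendsto q atTop (𝓝 q₀))
    (hg : Tendsto g atTop (𝓝 g₀)) : g₀ ∈ normalCone C q₀ :=
  ⟨hC.mem_of_tendsto hq (Eventually.of_forall fun k => (h k).1), fun q' hq' =>
    le_of_tendsto (hg.inner (tendsto_const_nhds.sub hq))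
      (Eventually.of_forall fun k => (h k).2 q' hq')⟩

end NormalCone

/-! ### Explicit description of `T_l`. -/

section Lagrangian

variable {n d : ℕ} (P : Data n d)

/-- The gradient in `(θ, ξ)` of the Lagrangian. -/
def Data.gradX (z : PD n d) : Primal n d :=
  WithLp.toLp 2 (z.fst.fst - P.Y - act (matA n).transpose z.snd.fst,
    -(act P.matB.transpose z.snd.fst + z.snd.snd))

/-- The smooth part of the Lagrangian. -/
def Data.smooth (x : Primal n d) (y : Dual n d) : ℝ :=
  1 / 2 * ‖x.fst - P.Y‖ ^ 2 - inner ℝ y.snd x.snd - inner ℝ y.fst (P.cons x)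

theorem Data.lagr_eq (x : Primal n d) (y : Dual n d) :
    P.lagr x y = (P.smooth x y : EReal) - conj (ind P.xiSet) (-y.snd)
      - conj (ind (orthant n)) (-y.fst) := by
  rw [Data.lagr, conj_ind_orthant, P.p_eq_ind]
  rfl

theorem Data.cons_sub (x x' : Primal n d) : P.cons x - P.cons x' = P.cons (x - x') := by
  simp only [Data.cons, WithLp.sub_fst, WithLp.sub_snd, act, map_sub]
  abel

theorem Data.inner_gradX (z : PD n d) (h : Primal n d) :
    inner ℝ (P.gradX z) h = inner ℝ (z.fst.fst - P.Y) h.fst - inner ℝ z.snd.fst (P.cons h)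
      - inner ℝ z.snd.snd h.snd := by
  rw [WithLp.prod_inner_apply]
  simp only [Data.gradX, WithLp.ofLp_fst, WithLp.ofLp_snd, Data.cons]
  rw [inner_sub_left, inner_neg_left, inner_add_left, inner_add_right,
    real_inner_comm h.fst (act _ _), inner_act_transpose,
    real_inner_comm h.snd (act _ _), inner_act_transpose,
    real_inner_comm z.snd.fst, real_inner_comm z.snd.fst]
  ring

/-- In (θ, ξ) the smooth part is affine plus ½‖θ‖², so its second-order expansion is exact. -/
theorem Data.smooth_eq (z : PD n d) (x : Primal n d) :
    P.smooth x z.snd = P.smooth z.fst z.snd + inner ℝ (P.gradX z) (x - z.fst)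
      + 1 / 2 * ‖(x - z.fst).fst‖ ^ 2 := by
  rw [P.inner_gradX, ← P.cons_sub, Data.smooth, Data.smooth]
  have h : x.fst - P.Y = (z.fst.fst - P.Y) + (x - z.fst).fst := by
    rw [WithLp.sub_fst]; abel
  rw [h, norm_add_sq_real, inner_sub_right, WithLp.sub_snd, inner_sub_right]
  ring

theorem Data.smooth_sub (x : Primal n d) (y y' : Dual n d) :
    P.smooth x y - P.smooth x y' = inner ℝ (P.cons x) (y'.fst - y.fst)
      + inner ℝ x.snd (y'.snd - y.snd) := by
  rw [Data.smooth, Data.smooth, inner_sub_right, inner_sub_right, real_inner_comm y.snd,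
    real_inner_comm y'.snd, real_inner_comm y.fst, real_inner_comm y'.fst]
  ring

theorem coe_sub_le_coe_iff (a c : ℝ) (X : EReal) :
    (a : EReal) - X ≤ c ↔ ((a - c : ℝ) : EReal) ≤ X := by
  induction X using EReal.rec with
  | bot =>
    rw [EReal.coe_sub_bot]
    exact iff_of_false (not_le.2 (EReal.coe_lt_top _)) (not_le.2 (EReal.bot_lt_coe _))
  | top => simp
  | coe x =>
    norm_cast
    constructor <;> intro h <;> linarith

theorem coe_sub_sub_coe (a b : ℝ) (X : EReal) :
    (a : EReal) - X - b = ((a - b : ℝ) : EReal) - X := by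
  induction X using EReal.rec with
  | bot => rw [EReal.coe_sub_bot, EReal.coe_sub_bot, EReal.top_sub_coe]
  | top => simp
  | coe x => norm_cast; ring

theorem eq_gradX_of_inner_sub_le {z : PD n d} {g : Primal n d}
    (h : ∀ x : Primal n d, inner ℝ g (x - z.fst) ≤
      inner ℝ (P.gradX z) (x - z.fst) + 1 / 2 * ‖(x - z.fst).fst‖ ^ 2) : g = P.gradX z := by
  -- A single test displacement D = g - `gradX` suffices: it gives ‖D‖² ≤ ½‖D.fst‖² ≤ ½‖D‖².
  have h1 := h (z.fst + (g - P.gradX z))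
  rw [add_sub_cancel_left] at h1
  have h2 : ‖g - P.gradX z‖ ^ 2 = inner ℝ g (g - P.gradX z)
      - inner ℝ (P.gradX z) (g - P.gradX z) := by
    rw [← inner_sub_left, real_inner_self_eq_norm_sq]
  have h3 := WithLp.prod_norm_sq_eq_of_L2 (g - P.gradX z)
  have h4 : ‖g - P.gradX z‖ ^ 2 ≤ 0 := by
    nlinarith [sq_nonneg ‖(g - P.gradX z).fst‖, sq_nonneg ‖(g - P.gradX z).snd‖]
  rw [← sub_eq_zero, ← norm_eq_zero]
  exact pow_eq_zero_iff two_ne_zero |>.1 (le_antisymm h4 (sq_nonneg _))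

variable {P}

/-- The operator `T_l` in terms of the gradient of the smooth part and of normal cones. -/
theorem mem_Tl_iff (hDne : P.D.Nonempty) (hDcl : IsClosed P.D) (hDcv : Convex ℝ P.D)
    {z w : PD n d} :
    w ∈ P.Tl z ↔ w.fst = P.gradX z ∧
      -z.snd.fst ∈ normalCone (orthant n) (P.cons z.fst - w.snd.fst) ∧
      -z.snd.snd ∈ normalCone P.xiSet (z.fst.snd - w.snd.snd) := by
  have hne := Data.xiSet_nonempty hDne
  have hcl := Data.xiSet_isClosed hDcl
  have hcv := Data.xiSet_convex hDcv
  constructor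
  · rintro ⟨h1, h2⟩
    -- At y = 0 the Lagrangian is finite, so the supergradient inequality prevents it from being ⊥
    -- at z; both conjugates are therefore finite.
    have h0 := h2 0
    obtain ⟨cv, hcv'⟩ : ∃ c : ℝ, conj (ind P.xiSet) (-z.snd.snd) = c := by
      refine ⟨_, (EReal.coe_toReal (fun ht => ?_) (conj_ind_ne_bot hne _)).symm⟩
      rw [P.lagr_eq, P.lagr_eq, ht] at h0
      simp [conj_ind_zero hne, conj_ind_zero orthant_nonempty] at h0
    obtain ⟨cu, hcu'⟩ : ∃ c : ℝ, conj (ind (orthant n)) (-z.snd.fst) = c := by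
      refine ⟨_, (EReal.coe_toReal (fun ht => ?_) (conj_ind_ne_bot orthant_nonempty _)).symm⟩
      rw [P.lagr_eq, P.lagr_eq, ht] at h0
      simp [conj_ind_zero hne, conj_ind_zero orthant_nonempty] at h0
    refine ⟨eq_gradX_of_inner_sub_le P fun x => ?_, ?_, ?_⟩
    · have h := h1 x
      rw [P.lagr_eq, P.lagr_eq, hcv', hcu', P.smooth_eq z x] at h
      have h' : P.smooth z.fst z.snd - cv - cu + inner ℝ w.fst (x - z.fst) ≤
        P.smooth z.fst z.snd + inner ℝ (P.gradX z) (x - z.fst)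
          + 1 / 2 * ‖(x - z.fst).fst‖ ^ 2 - cv - cu := by exact_mod_cast h
      linarith
    · rw [mem_normalCone_iff_conj orthant_nonempty orthant_isClosed orthant_convex hcu']
      intro g
      -- Varying u alone keeps the conjugate term in v fixed, isolating the Fenchel inequality for
      -- the orthant; likewise below with v.
      have h := h2 (WithLp.toLp 2 (-g, z.snd.snd))
      rw [P.lagr_eq, P.lagr_eq, hcv', hcu', ← EReal.coe_sub, ← EReal.coe_sub,
        ← EReal.coe_add] at h
      simp only [WithLp.toLp_fst, WithLp.toLp_snd, hcv', neg_neg] at h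
      rw [← EReal.coe_sub, coe_sub_le_coe_iff] at h
      refine le_trans (le_of_eq ?_) h
      have e := P.smooth_sub z.fst (WithLp.toLp 2 (-g, z.snd.snd)) z.snd
      have e' : inner ℝ (-w.snd) (WithLp.toLp 2 (-g, z.snd.snd) - z.snd)
          = -inner ℝ w.snd.fst (-g - z.snd.fst) := by
        rw [WithLp.prod_inner_apply]
        simp
      rw [e']
      simp only [WithLp.toLp_fst, WithLp.toLp_snd, sub_self, inner_zero_right, add_zero] at e
      congr 1
      have e2 : inner ℝ (P.cons z.fst - w.snd.fst) (g - -z.snd.fst) =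
        inner ℝ (P.cons z.fst) (z.snd.fst - -g) + inner ℝ w.snd.fst (-g - z.snd.fst) := by
        simp only [inner_sub_left, inner_sub_right, inner_neg_right]; ring
      rw [e2, ← e]
      ring
    · rw [mem_normalCone_iff_conj hne hcl hcv hcv']
      intro g
      have h := h2 (WithLp.toLp 2 (z.snd.fst, -g))
      rw [P.lagr_eq, P.lagr_eq, hcv', hcu', ← EReal.coe_sub, ← EReal.coe_sub,
        ← EReal.coe_add] at h
      simp only [WithLp.toLp_fst, WithLp.toLp_snd, hcu', neg_neg] at h
      rw [coe_sub_sub_coe, coe_sub_le_coe_iff] at h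
      refine le_trans (le_of_eq ?_) h
      have e := P.smooth_sub z.fst (WithLp.toLp 2 (z.snd.fst, -g)) z.snd
      have e' : inner ℝ (-w.snd) (WithLp.toLp 2 (z.snd.fst, -g) - z.snd)
          = -inner ℝ w.snd.snd (-g - z.snd.snd) := by
        rw [WithLp.prod_inner_apply]
        simp
      rw [e']
      simp only [WithLp.toLp_fst, WithLp.toLp_snd, sub_self, inner_zero_right, zero_add] at e
      congr 1
      have e2 : inner ℝ (z.fst.snd - w.snd.snd) (g - -z.snd.snd) =
        inner ℝ z.fst.snd (z.snd.snd - -g) + inner ℝ w.snd.snd (-g - z.snd.snd) := by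
        simp only [inner_sub_left, inner_sub_right, inner_neg_right]; ring
      rw [e2, ← e]
      ring
  · rintro ⟨h1, h2, h3⟩
    have hu := conj_ind_eq_of_mem_normalCone h2
    have hv := conj_ind_eq_of_mem_normalCone h3
    refine ⟨fun x => ?_, fun y => ?_⟩
    · rw [P.lagr_eq, P.lagr_eq, hu, hv, h1, P.smooth_eq z x]
      norm_cast
      linarith [sq_nonneg ‖(x - z.fst).fst‖]
    · rw [P.lagr_eq, P.lagr_eq, hu, hv]
      refine (EReal.sub_le_sub (EReal.sub_le_sub le_rfl (inner_le_conj_ind h3.1 _))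
        (inner_le_conj_ind h2.1 _)).trans ?_
      norm_cast
      have e := P.smooth_sub z.fst y z.snd
      have e' : inner ℝ (-w.snd) (y - z.snd) = -inner ℝ w.snd.fst (y.fst - z.snd.fst)
          - inner ℝ w.snd.snd (y.snd - z.snd.snd) := by
        rw [WithLp.prod_inner_apply]
        simp
        ring
      rw [e']
      simp only [inner_sub_left, inner_sub_right, inner_neg_right] at e ⊢
      linarith

end Lagrangian

/-! ### KKT points as zeros; monotonicity and closed graph of `T_l`. -/

section Operator

variable {n d : ℕ} {P : Data n d}

theorem kktSet_eq_Lam (hDne : P.D.Nonempty) (hDcl : IsClosed P.D) (hDcv : Convex ℝ P.D) :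
    P.kktSet = P.Lam := by
  ext z
  rw [Data.Lam, Set.mem_ofPred_eq, mem_Tl_iff hDne hDcl hDcv, Data.kktSet, Set.mem_ofPred_eq,
    P.p_eq_ind, subdiff_ind (Data.xiSet_nonempty hDne), subdiff_ind orthant_nonempty]
  have h : (0 : PD n d).fst = P.gradX z ↔ z.fst.fst - P.Y - act (matA n).transpose z.snd.fst = 0 ∧
      act P.matB.transpose z.snd.fst + z.snd.snd = 0 := by
    constructor
    · intro h
      have h1 := congrArg (fun x : Primal n d => x.fst) h
      have h2 := congrArg (fun x : Primal n d => x.snd) h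
      exact ⟨h1.symm, neg_eq_zero.1 h2.symm⟩
    · rintro ⟨h1, h2⟩
      rw [Data.gradX, h1, h2, neg_zero]
      rfl
  rw [h]
  simp only [WithLp.zero_snd, WithLp.zero_fst, sub_zero]
  tauto

/-- The coupling of (θ, ξ) with (u, v) is skew and cancels, leaving ‖θ - θ'‖² and two normal-cone
terms. -/
theorem isMonotoneOp_Tl (hDne : P.D.Nonempty) (hDcl : IsClosed P.D) (hDcv : Convex ℝ P.D) :
    IsMonotoneOp P.Tl := by
  intro z w z' w' h h'
  obtain ⟨h1, h2, h3⟩ := (mem_Tl_iff hDne hDcl hDcv).1 h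
  obtain ⟨h1', h2', h3'⟩ := (mem_Tl_iff hDne hDcl hDcv).1 h'
  have m2 := normalCone_monotone h2 h2'
  have m3 := normalCone_monotone h3 h3'
  have e : inner ℝ (w - w') (z - z') = inner ℝ (P.gradX z) (z.fst - z'.fst)
      - inner ℝ (P.gradX z') (z.fst - z'.fst)
      + inner ℝ (w.snd.fst - w'.snd.fst) (z.snd.fst - z'.snd.fst)
      + inner ℝ (w.snd.snd - w'.snd.snd) (z.snd.snd - z'.snd.snd) := by
    rw [← inner_sub_left, ← h1, ← h1', WithLp.prod_inner_apply,
      WithLp.prod_inner_apply (WithLp.ofLp (w - w')).2, ← add_assoc]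
    rfl
  have e4 : inner ℝ (z.fst.fst - P.Y) (z.fst.fst - z'.fst.fst)
      - inner ℝ (z'.fst.fst - P.Y) (z.fst.fst - z'.fst.fst) = ‖z.fst.fst - z'.fst.fst‖ ^ 2 := by
    rw [← inner_sub_left, sub_sub_sub_cancel_right, real_inner_self_eq_norm_sq]
  rw [e, P.inner_gradX, P.inner_gradX, ← P.cons_sub, WithLp.sub_fst, WithLp.sub_snd]
  have := sq_nonneg ‖z.fst.fst - z'.fst.fst‖
  rw [← e4] at this
  simp only [inner_sub_left, inner_sub_right, inner_neg_left] at m2 m3 this ⊢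
  rw [real_inner_comm z.snd.fst w.snd.fst, real_inner_comm z'.snd.fst w.snd.fst,
    real_inner_comm z.snd.fst w'.snd.fst, real_inner_comm z'.snd.fst w'.snd.fst,
    real_inner_comm z.snd.snd w.snd.snd, real_inner_comm z'.snd.snd w.snd.snd,
    real_inner_comm z.snd.snd w'.snd.snd, real_inner_comm z'.snd.snd w'.snd.snd]
  linarith

theorem continuous_act {ι κ : Type*} [Fintype κ] [DecidableEq κ] [Fintype ι] (M : Matrix ι κ ℝ) :
    Continuous (act M) :=
  (Matrix.toEuclideanLin M).continuous_of_finiteDimensional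

theorem continuous_cons : Continuous P.cons :=
  ((continuous_act _).comp (by fun_prop)).add ((continuous_act _).comp (by fun_prop))

theorem continuous_gradX : Continuous P.gradX := by
  have h1 := continuous_act (matA n).transpose
  have h2 := continuous_act P.matB.transpose
  unfold Data.gradX
  fun_prop

theorem mem_Tl_of_tendsto (hDne : P.D.Nonempty) (hDcl : IsClosed P.D) (hDcv : Convex ℝ P.D)
    (x g : ℕ → PD n d) (x₀ g₀ : PD n d) (h : ∀ k, g k ∈ P.Tl (x k))
    (hx : Tendsto x atTop (𝓝 x₀)) (hg : Tendsto g atTop (𝓝 g₀)) : g₀ ∈ P.Tl x₀ := by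
  simp only [mem_Tl_iff hDne hDcl hDcv] at h ⊢
  have c1 : Continuous fun z : PD n d => z.fst := by fun_prop
  have c2 : Continuous fun z : PD n d => z.fst.snd := by fun_prop
  have c3 : Continuous fun z : PD n d => z.snd.fst := by fun_prop
  have c4 : Continuous fun z : PD n d => z.snd.snd := by fun_prop
  have t {F : Type} [TopologicalSpace F] {f : PD n d → F} (hf : Continuous f) :
      Tendsto (fun k => f (x k)) atTop (𝓝 (f x₀)) := (hf.tendsto x₀).comp hx
  have s {F : Type} [TopologicalSpace F] {f : PD n d → F} (hf : Continuous f) :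
      Tendsto (fun k => f (g k)) atTop (𝓝 (f g₀)) := (hf.tendsto g₀).comp hg
  refine ⟨tendsto_nhds_unique (s c1) ((t continuous_gradX).congr fun k => (h k).1.symm), ?_, ?_⟩
  · exact normalCone_of_tendsto orthant_isClosed (fun k => (h k).2.1)
      ((t (continuous_cons.comp c1)).sub (s c3)) (t c3.neg)
  · exact normalCone_of_tendsto (Data.xiSet_isClosed hDcl) (fun k => (h k).2.2)
      ((t c2).sub (s c4)) (t c4.neg)

end Operator

/-! ### Zeros of `T_l` solve (P) and (D). -/

section Optimality

variable {n d : ℕ} {P : Data n d}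

theorem optimality_of_mem_Lam (hDne : P.D.Nonempty) (hDcl : IsClosed P.D) (hDcv : Convex ℝ P.D)
    {z : PD n d} (hz : z ∈ P.Lam) :
    P.gradX z = 0 ∧ -z.snd.fst ∈ normalCone (orthant n) (P.cons z.fst) ∧
      -z.snd.snd ∈ normalCone P.xiSet z.fst.snd := by
  have hz' : (0 : PD n d) ∈ P.Tl z := hz
  have h := (mem_Tl_iff hDne hDcl hDcv).1 hz'
  simp only [WithLp.zero_snd, WithLp.zero_fst, sub_zero] at h
  exact ⟨h.1.symm, h.2⟩

theorem isPrimalOptimal_of_mem_Lam (hDne : P.D.Nonempty) (hDcl : IsClosed P.D)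
    (hDcv : Convex ℝ P.D) {z : PD n d} (hz : z ∈ P.Lam) : P.IsPrimalOptimal z.fst := by
  obtain ⟨h1, h2, h3⟩ := optimality_of_mem_Lam hDne hDcl hDcv hz
  have hval : P.primalObj z.fst = ((1 / 2 * ‖z.fst.fst - P.Y‖ ^ 2 : ℝ) : EReal) := by
    rw [Data.primalObj, P.p_eq_ind, ind_of_mem h2.1, ind_of_mem h3.1, add_zero, add_zero]
  refine ⟨by rw [hval]; exact EReal.coe_ne_top _, fun x => ?_⟩
  rw [hval, Data.primalObj, P.p_eq_ind]
  by_cases hx : x.snd ∈ P.xiSet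
  · by_cases hc : P.cons x ∈ orthant n
    · rw [ind_of_mem hx, ind_of_mem hc, add_zero, add_zero, EReal.coe_le_coe_iff]
      have e1 := P.inner_gradX z (x - z.fst)
      rw [h1, inner_zero_left, ← P.cons_sub] at e1
      have e2 := h2.2 _ hc
      have e3 := h3.2 _ hx
      rw [inner_neg_left] at e2 e3
      have e4 : x.fst - P.Y = (z.fst.fst - P.Y) + (x - z.fst).fst := by
        rw [WithLp.sub_fst]; abel
      rw [e4, norm_add_sq_real]
      rw [WithLp.sub_snd] at e1
      nlinarith [sq_nonneg ‖(x - z.fst).fst‖]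
    · rw [ind_of_notMem hc, ind_of_mem hx, add_zero, EReal.coe_add_top]
      exact le_top
  · have hb : ind (orthant n) (P.cons x) ≠ ⊥ := by
      rw [ind]; split_ifs <;> simp
    rw [ind_of_notMem hx, EReal.coe_add_top, EReal.top_add_of_ne_bot hb]
    exact le_top

theorem isDualOptimal_of_mem_Lam (hDne : P.D.Nonempty) (hDcl : IsClosed P.D)
    (hDcv : Convex ℝ P.D) {z : PD n d} (hz : z ∈ P.Lam) : P.IsDualOptimal z.snd := by
  obtain ⟨h1, h2, h3⟩ := optimality_of_mem_Lam hDne hDcl hDcv hz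
  have hkkt := hz
  rw [← kktSet_eq_Lam hDne hDcl hDcv] at hkkt
  obtain ⟨k1, k2, -, -⟩ := hkkt
  have hu : ind (orthant n) z.snd.fst = ((inner ℝ (P.cons z.fst) (-z.snd.fst) : ℝ) : EReal) := by
    rw [← conj_ind_orthant, conj_ind_eq_of_mem_normalCone h2]
  have hv := conj_ind_eq_of_mem_normalCone h3
  refine ⟨k2, ?_, fun y hy => ?_⟩
  · rw [Data.dualObj, P.p_eq_ind, hv, hu, ← EReal.coe_sub, ← EReal.coe_sub]
    exact EReal.coe_ne_bot _
  · rw [Data.dualObj, Data.dualObj, P.p_eq_ind, hv, hu, ← conj_ind_orthant]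
    refine (EReal.sub_le_sub (EReal.sub_le_sub le_rfl (inner_le_conj_ind h3.1 _))
      (inner_le_conj_ind h2.1 _)).trans ?_
    norm_cast
    -- The dual constraint eliminates v = -Bᵀu, so the lower bounds on the conjugates collapse to a
    -- term in Aᵀu; completing the square at Aᵀu = θ - Y finishes.
    have key : ∀ y' : Dual n d, P.DualConstraint y' →
        inner ℝ z.fst.snd (-y'.snd) + inner ℝ (P.cons z.fst) (-y'.fst)
          = -inner ℝ z.fst.fst (act (matA n).transpose y'.fst) := by
      intro y' hy'
      have : y'.snd = -act P.matB.transpose y'.fst := eq_neg_of_add_eq_zero_right hy'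
      rw [this, neg_neg, inner_act_transpose, inner_act_transpose, Data.cons, inner_neg_right,
        inner_add_left]
      ring
    have e1 := key y hy
    have e2 := key z.snd k2
    have e3 : act (matA n).transpose z.snd.fst = z.fst.fst - P.Y := (sub_eq_zero.1 k1).symm
    have e4 := sq_nonneg ‖act (matA n).transpose y.fst - (z.fst.fst - P.Y)‖
    rw [norm_sub_sq_real, inner_sub_right, real_inner_comm z.fst.fst, real_inner_comm P.Y] at e4
    rw [e3] at e2 ⊢
    have e5 : inner ℝ z.fst.fst (z.fst.fst - P.Y) - inner ℝ P.Y (z.fst.fst - P.Y)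
        = ‖z.fst.fst - P.Y‖ ^ 2 := by
      rw [← inner_sub_left, real_inner_self_eq_norm_sq]
    linarith

end Optimality

/-! ### The gradient of Φ, the proximal step and the resolvents. -/

section Gradient

theorem hasFDerivAt_mul_comp_sub {E F : Type*} [NormedAddCommGroup E] [NormedSpace ℝ E]
    [FiniteDimensional ℝ E] [NormedAddCommGroup F] [InnerProductSpace ℝ F] [CompleteSpace F]
    {f : F → ℝ} (K : E →ₗ[ℝ] F) (b : F) (c : ℝ) {g : F} {x : E}
    (hf : HasGradientAt f g (K x - b)) :
    HasFDerivAt (fun x => c * f (K x - b))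
      (c • (innerSL ℝ g).comp (LinearMap.toContinuousLinearMap K)) x := by
  have h1 : HasFDerivAt (fun x => K x - b) (LinearMap.toContinuousLinearMap K) x :=
    ((LinearMap.toContinuousLinearMap K).hasFDerivAt).sub_const b
  exact (HasFDerivAt.comp x hf.hasFDerivAt h1).const_mul c

theorem hasGradientAt_norm_sq {F : Type*} [NormedAddCommGroup F] [InnerProductSpace ℝ F]
    [CompleteSpace F] (x : F) : HasGradientAt (fun y : F => ‖y‖ ^ 2) ((2 : ℝ) • x) x := by
  rw [hasGradientAt_iff_hasFDerivAt]
  refine (hasStrictFDerivAt_norm_sq x).hasFDerivAt.congr_fderiv ?_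
  ext h
  simp

theorem hasGradientAt_wnorm_sq {ι : Type*} [Fintype ι] [DecidableEq ι] {H : Matrix ι ι ℝ}
    (hH : H.PosDef) (x : EuclideanSpace ℝ ι) :
    HasGradientAt (fun y => wnorm H y ^ 2) ((2 : ℝ) • act H x) x := by
  have h := hasFDerivAt_mul_comp_sub (x := x) (sqrtCoord hH.1) 0 1 (hasGradientAt_norm_sq _)
  rw [hasGradientAt_iff_hasFDerivAt]
  have e : (fun y => wnorm H y ^ 2) = fun y => 1 * ‖sqrtCoord hH.1 y - 0‖ ^ 2 := by
    funext y
    rw [wnorm_sq hH, inner_sqrtCoord hH, real_inner_self_eq_norm_sq, one_mul, sub_zero]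
  rw [e]
  refine h.congr_fderiv ?_
  ext v
  simp [← inner_sqrtCoord hH, inner_act_comm hH.1]

variable {n d : ℕ} (P : Data n d)

/-- The multiplier update. -/
def Data.update (σ : ℝ) (y : Dual n d) (x : Primal n d) : Dual n d :=
  WithLp.toLp 2
    (-(σ • (P.cons x - σ⁻¹ • y.fst - prox (ind (orthant n)) (P.cons x - σ⁻¹ • y.fst))),
      -(σ • (x.snd - σ⁻¹ • y.snd - prox P.p (x.snd - σ⁻¹ • y.snd))))

/-- `(θ, ξ) ↦ Aθ + Bξ` as a linear map. -/
def Data.consLin : Primal n d →ₗ[ℝ] USp n :=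
  (Matrix.toEuclideanLin (matA n)).comp (WithLp.fstₗ 2 ℝ (ThetaSp n) (XiSp n d))
    + (Matrix.toEuclideanLin P.matB).comp (WithLp.sndₗ 2 ℝ (ThetaSp n) (XiSp n d))

variable {P} {H₁ : Matrix (Fin n) (Fin n) ℝ} {H₂ : Matrix (Fin n × Fin d) (Fin n × Fin d) ℝ}

/-- Differentiating σE(· - u/σ) gives σ times the prox residual, which is minus the updated
multiplier. So the augmented Lagrangian has the gradient of the ordinary one at the new multipliers.
-/
theorem hasGradientAt_Phi (hDne : P.D.Nonempty) (hDcl : IsClosed P.D) (hDcv : Convex ℝ P.D)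
    (hH₁ : H₁.PosDef) (hH₂ : H₂.PosDef) {σ : ℝ} (z : PD n d) (x : Primal n d) :
    HasGradientAt (Phi P H₁ H₂ σ z) (P.gradX (WithLp.toLp 2 (x, P.update σ z.snd x))
      + σ⁻¹ • WithLp.toLp 2 (act H₁ (x.fst - z.fst.fst), act H₂ (x.snd - z.fst.snd))) x := by
  have d1 := hasFDerivAt_mul_comp_sub (x := x) (WithLp.fstₗ 2 ℝ (ThetaSp n) (XiSp n d)) P.Y
    (1 / 2) (hasGradientAt_norm_sq _)
  have d2 := hasFDerivAt_mul_comp_sub (x := x) (WithLp.sndₗ 2 ℝ (ThetaSp n) (XiSp n d))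
    (σ⁻¹ • z.snd.snd) σ (hasGradientAt_moreau_ind (Data.xiSet_nonempty hDne)
      (Data.xiSet_isClosed hDcl) (Data.xiSet_convex hDcv) _)
  have d3 := hasFDerivAt_mul_comp_sub (x := x) P.consLin
    (σ⁻¹ • z.snd.fst) σ (hasGradientAt_moreau_ind orthant_nonempty orthant_isClosed
      orthant_convex _)
  have d4 := hasFDerivAt_mul_comp_sub (x := x) (WithLp.fstₗ 2 ℝ (ThetaSp n) (XiSp n d)) z.fst.fst
    (1 / (2 * σ)) (hasGradientAt_wnorm_sq hH₁ _)
  have d5 := hasFDerivAt_mul_comp_sub (x := x) (WithLp.sndₗ 2 ℝ (ThetaSp n) (XiSp n d)) z.fst.snd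
    (1 / (2 * σ)) (hasGradientAt_wnorm_sq hH₂ _)
  have hsum := ((((((d1.add d2).add d3).sub_const (1 / (2 * σ) * ‖z.snd.fst‖ ^ 2)).sub_const
    (1 / (2 * σ) * ‖z.snd.snd‖ ^ 2)).add d4).add d5)
  rw [← P.p_eq_ind] at hsum
  rw [hasGradientAt_iff_hasFDerivAt]
  refine HasFDerivAt.congr_fderiv hsum ?_
  ext h
  change _ = inner ℝ _ h
  rw [inner_add_left, P.inner_gradX, real_inner_smul_left, WithLp.prod_inner_apply]
  have hc : ∀ x, P.consLin x = P.cons x := fun _ => rfl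
  simp [real_inner_smul_left, inner_neg_left, Data.update, hc]
  simp only [inner_sub_left, real_inner_smul_left]
  ring

theorem smul_mem_normalCone {E : Type*} [NormedAddCommGroup E] [InnerProductSpace ℝ E] {C : Set E}
    {q g : E} {t : ℝ} (ht : 0 ≤ t) (h : g ∈ normalCone C q) : t • g ∈ normalCone C q :=
  ⟨h.1, fun q' hq' => by
    rw [real_inner_smul_left]
    exact mul_nonpos_of_nonneg_of_nonpos ht (h.2 q' hq')⟩

/-- One step of the method is an inexact step of the proximal point method for `T_l`. -/
theorem step_mem_Tl (hDne : P.D.Nonempty) (hDcl : IsClosed P.D) (hDcv : Convex ℝ P.D)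
    (hH₁ : H₁.PosDef) (hH₂ : H₂.PosDef) {σ : ℝ} (hσ : 0 < σ) {z z' : PD n d}
    (h : z'.snd = P.update σ z.snd z'.fst) :
    σ⁻¹ • sigOp H₁ H₂ (z - z')
      + WithLp.toLp 2 (gradient (Phi P H₁ H₂ σ z) z'.fst, 0) ∈ P.Tl z' := by
  -- Subtracting the scaled multiplier change from c recovers the projected point, where the
  -- normal-cone inclusion is known.
  have key {E : Type} [NormedAddCommGroup E] [InnerProductSpace ℝ E] (c u q : E) :
      c - (σ⁻¹ • (u - -(σ • (c - σ⁻¹ • u - q))) + 0) = q := by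
    rw [add_zero, sub_neg_eq_add, smul_add, smul_smul, inv_mul_cancel₀ hσ.ne', one_smul]
    abel
  rw [mem_Tl_iff hDne hDcl hDcv]
  have hz' : z' = WithLp.toLp 2 (z'.fst, P.update σ z.snd z'.fst) := by rw [← h]; rfl
  refine ⟨?_, ?_, ?_⟩
  · rw [(hasGradientAt_Phi hDne hDcl hDcv hH₁ hH₂ z z'.fst).gradient, ← hz']
    have e : WithLp.toLp 2 (act H₁ (z'.fst.fst - z.fst.fst), act H₂ (z'.fst.snd - z.fst.snd))
        = -(sigOp H₁ H₂ (z - z')).fst := by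
      rw [← neg_sub z.fst.fst, ← neg_sub z.fst.snd, act, act, map_neg, map_neg]
      rfl
    rw [e, WithLp.add_fst, WithLp.smul_fst, WithLp.toLp_fst, smul_neg]
    exact add_add_neg_cancel'_right _ _
  · have e : P.cons z'.fst - (σ⁻¹ • sigOp H₁ H₂ (z - z')
        + WithLp.toLp 2 (gradient (Phi P H₁ H₂ σ z) z'.fst, 0)).snd.fst
        = prox (ind (orthant n)) (P.cons z'.fst - σ⁻¹ • z.snd.fst) := by
      refine Eq.trans ?_ (key (P.cons z'.fst) z.snd.fst _)
      have h' : z'.snd.fst = _ := congrArg (fun y : Dual n d => y.fst) h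
      change P.cons z'.fst - (σ⁻¹ • (z.snd.fst - z'.snd.fst) + 0) = _
      rw [h']
      rfl
    rw [e, h]
    change - -(σ • _) ∈ _
    rw [neg_neg]
    exact smul_mem_normalCone hσ.le
      (prox_ind_spec orthant_nonempty orthant_isClosed orthant_convex _)
  · have e : z'.fst.snd - (σ⁻¹ • sigOp H₁ H₂ (z - z')
        + WithLp.toLp 2 (gradient (Phi P H₁ H₂ σ z) z'.fst, 0)).snd.snd
        = prox P.p (z'.fst.snd - σ⁻¹ • z.snd.snd) := by
      refine Eq.trans ?_ (key z'.fst.snd z.snd.snd _)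
      have h' : z'.snd.snd = _ := congrArg (fun y : Dual n d => y.snd) h
      change z'.fst.snd - (σ⁻¹ • (z.snd.snd - z'.snd.snd) + 0) = _
      rw [h']
      rfl
    rw [e, h]
    change - -(σ • _) ∈ _
    rw [neg_neg, P.p_eq_ind]
    exact smul_mem_normalCone hσ.le
      (prox_ind_spec (Data.xiSet_nonempty hDne) (Data.xiSet_isClosed hDcl)
        (Data.xiSet_convex hDcv) _)

theorem moreau_ind_nonneg {E : Type*} [NormedAddCommGroup E] [InnerProductSpace ℝ E]
    [CompleteSpace E] {C : Set E} (hne : C.Nonempty) (hcl : IsClosed C) (hcv : Convex ℝ C)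
    (x : E) : 0 ≤ moreau (ind C) x := by
  rw [moreau_ind hne hcl hcv]
  positivity

/-- The envelopes are nonnegative, so the proximal quadratic makes Φ coercive. An exact minimizer
will provide the resolvent. -/
theorem exists_isMin_Phi (hDne : P.D.Nonempty) (hDcl : IsClosed P.D) (hDcv : Convex ℝ P.D)
    {σ : ℝ} (hσ : 0 < σ) (z : PD n d) :
    ∃ x, ∀ x', Phi P 1 1 σ z x ≤ Phi P 1 1 σ z x' := by
  have hcont : Continuous (Phi P 1 1 σ z) := continuous_iff_continuousAt.2 fun x =>
    (hasGradientAt_Phi hDne hDcl hDcv Matrix.PosDef.one Matrix.PosDef.one z x).continuousAt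
  refine hcont.exists_forall_le ?_
  have hlow : ∀ x, 1 / (2 * σ) * ‖x - z.fst‖ ^ 2 - (1 / (2 * σ) * ‖z.snd.fst‖ ^ 2
      + 1 / (2 * σ) * ‖z.snd.snd‖ ^ 2) ≤ Phi P 1 1 σ z x := by
    intro x
    have h1 := mul_nonneg hσ.le (moreau_ind_nonneg (Data.xiSet_nonempty hDne)
      (Data.xiSet_isClosed hDcl) (Data.xiSet_convex hDcv) (x.snd - σ⁻¹ • z.snd.snd))
    have h2 := mul_nonneg hσ.le (moreau_ind_nonneg orthant_nonempty orthant_isClosed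
      orthant_convex (P.cons x - σ⁻¹ • z.snd.fst))
    rw [Phi, Data.augLagr, P.p_eq_ind, wnorm_sq Matrix.PosDef.one, wnorm_sq Matrix.PosDef.one,
      WithLp.prod_norm_sq_eq_of_L2]
    simp only [act, Matrix.toLpLin_one, LinearMap.id_apply, real_inner_self_eq_norm_sq,
      WithLp.sub_fst, WithLp.sub_snd]
    linarith [sq_nonneg ‖x.fst - P.Y‖]
  refine tendsto_atTop_mono hlow ?_
  have h1 : Tendsto (fun x : Primal n d => ‖x - z.fst‖) (cocompact _) atTop := by
    refine tendsto_atTop_mono (fun x => norm_sub_norm_le x z.fst) ?_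
    exact tendsto_atTop_add_const_right _ _ tendsto_norm_cocompact_atTop
  exact tendsto_atTop_add_const_right _ _
    (((tendsto_pow_atTop two_ne_zero).comp h1).const_mul_atTop (by positivity))

/-- The resolvents of `T_l` are defined everywhere. -/
theorem exists_sub_smul_mem_Tl (hDne : P.D.Nonempty) (hDcl : IsClosed P.D) (hDcv : Convex ℝ P.D)
    (η : ℝ) (hη : 0 < η) (y : PD n d) : ∃ x : PD n d, y - η • x ∈ P.Tl x := by
  -- An exact step with identity weights, penalty η⁻¹ and base point η⁻¹y yields the value η(η⁻¹y -
  -- x) = y - ηx.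
  obtain ⟨x, hx⟩ := exists_isMin_Phi hDne hDcl hDcv (inv_pos.2 hη) (η⁻¹ • y)
  have hgrad : gradient (Phi P 1 1 η⁻¹ (η⁻¹ • y)) x = 0 := by
    rw [gradient, IsLocalMin.fderiv_eq_zero (Eventually.of_forall hx), map_zero]
  have h := step_mem_Tl (P := P) (z := η⁻¹ • y)
    (z' := WithLp.toLp 2 (x, P.update η⁻¹ (η⁻¹ • y).snd x)) hDne hDcl hDcv
    Matrix.PosDef.one Matrix.PosDef.one (inv_pos.2 hη) rfl
  refine ⟨WithLp.toLp 2 (x, P.update η⁻¹ (η⁻¹ • y).snd x), ?_⟩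
  · convert h using 1
    have hs : ∀ a : PD n d, sigOp (1 : Matrix (Fin n) (Fin n) ℝ) 1 a = a := by
      intro a
      simp only [sigOp, diagOp, Matrix.toLpLin_one]
      rfl
    have h0 : (WithLp.toLp 2 (gradient (Phi P 1 1 η⁻¹ (η⁻¹ • y)) x, 0) : PD n d) = 0 := by
      rw [hgrad]; rfl
    rw [WithLp.toLp_fst, h0, hs, add_zero, inv_inv, smul_sub, smul_smul,
      mul_inv_cancel₀ hη.ne', one_smul]

end Gradient

/-! ### Limits of μₖ and μ_∞. -/

section Rates

theorem tendsto_mu {κ lam : ℝ} (hκ : 0 < κ) (hlam : 1 ≤ lam) {σ δ : ℕ → ℝ}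
    (hσm : Monotone σ) {σinf : EReal}
    (hσlim : Tendsto (fun k => (σ k : EReal)) atTop (𝓝 σinf)) (hδ : Tendsto δ atTop (𝓝 0)) :
    Tendsto (fun k => mu κ lam (σ k) (δ k)) atTop (𝓝 (muInf κ lam σinf)) := by
  have hkl : 0 < κ ^ 2 * lam ^ 2 := by positivity
  suffices h : Tendsto (fun k => (√(σ k ^ 2 + κ ^ 2 * lam ^ 2))⁻¹) atTop
      (𝓝 (if σinf = ⊤ then 0 else (√(σinf.toReal ^ 2 + κ ^ 2 * lam ^ 2))⁻¹)) by
    have h1 : Tendsto (fun k => 1 / (1 - δ k)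
        * (δ k + (1 + δ k) * κ * lam * (√(σ k ^ 2 + κ ^ 2 * lam ^ 2))⁻¹)) atTop
        (𝓝 (1 / (1 - 0) * (0 + (1 + 0) * κ * lam
          * (if σinf = ⊤ then 0 else (√(σinf.toReal ^ 2 + κ ^ 2 * lam ^ 2))⁻¹)))) :=
      (tendsto_const_nhds.div (tendsto_const_nhds.sub hδ) (by norm_num)).mul
        (hδ.add ((((tendsto_const_nhds.add hδ).mul_const κ).mul_const lam).mul h))
    have e : 1 / (1 - 0) * (0 + (1 + 0) * κ * lam
          * (if σinf = ⊤ then 0 else (√(σinf.toReal ^ 2 + κ ^ 2 * lam ^ 2))⁻¹))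
        = muInf κ lam σinf := by
      rw [muInf]
      split_ifs <;> ring
    rw [e] at h1
    exact h1
  split_ifs with htop
  · rw [htop] at hσlim
    have hσ : Tendsto σ atTop atTop := EReal.tendsto_coe_nhds_top_iff.1 hσlim
    refine tendsto_inv_atTop_zero.comp (tendsto_atTop_mono (fun k => ?_) hσ)
    exact Real.le_sqrt_of_sq_le (by linarith)
  · have hbot : σinf ≠ ⊥ := by
      have : (σ 0 : EReal) ≤ σinf := ge_of_tendsto hσlim
        (Eventually.of_forall fun k => EReal.coe_le_coe_iff.2 (hσm (Nat.zero_le k)))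
      exact ne_bot_of_le_ne_bot (EReal.coe_ne_bot _) this
    lift σinf to ℝ using ⟨htop, hbot⟩
    have hσ : Tendsto σ atTop (𝓝 σinf) := EReal.tendsto_coe.1 hσlim
    rw [EReal.toReal_coe]
    exact (((hσ.pow 2).add_const _).sqrt).inv₀ (by positivity)

theorem muInf_lt_one {κ lam : ℝ} (hκ : 0 < κ) (hlam : 1 ≤ lam) {σinf : EReal} (h : 0 < σinf) :
    muInf κ lam σinf < 1 := by
  rw [muInf]
  split_ifs with htop
  · exact one_pos
  · have hs : 0 < σinf.toReal := EReal.toReal_pos h htop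
    rw [div_lt_one (by positivity)]
    exact Real.lt_sqrt_of_sq_lt (by nlinarith [pow_pos hs 2])

theorem tendsto_muInf (κ lam : ℝ) :
    Tendsto (fun s : ℝ => muInf κ lam (s : EReal)) atTop (𝓝 0) := by
  have h : Tendsto (fun s : ℝ => √(s ^ 2 + κ ^ 2 * lam ^ 2)) atTop atTop :=
    tendsto_atTop_mono (fun s => Real.le_sqrt_of_sq_le
      (le_add_of_nonneg_right (by positivity))) tendsto_id
  simpa [muInf] using h.const_div_atTop (κ * lam)

end Rates

/-! ### Weighted distances along the iterates. -/

section Main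

variable {n d : ℕ} {P : Data n d}
  {H₁ : Matrix (Fin n) (Fin n) ℝ} {H₂ : Matrix (Fin n × Fin d) (Fin n × Fin d) ℝ}
  {σ ε : ℕ → ℝ} {z : ℕ → PD n d}

theorem distSig_le {C : Set (PD n d)} (x : PD n d) {w : PD n d} (hw : w ∈ C) :
    distSig H₁ H₂ x C ≤ normSig H₁ H₂ (x - w) :=
  ciInf_le ⟨0, by rintro _ ⟨w, rfl⟩; exact Real.sqrt_nonneg _⟩ (⟨w, hw⟩ : C)

theorem exists_normSig_lt {C : Set (PD n d)} (hC : C.Nonempty) {x : PD n d} {t : ℝ}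
    (h : distSig H₁ H₂ x C < t) : ∃ w ∈ C, normSig H₁ H₂ (x - w) < t := by
  have := hC.to_subtype
  obtain ⟨w, hw⟩ := exists_lt_of_ciInf_lt h
  exact ⟨w, w.2, hw⟩

theorem distSig_nonneg (C : Set (PD n d)) (x : PD n d) : 0 ≤ distSig H₁ H₂ x C :=
  Real.iInf_nonneg fun _ => Real.sqrt_nonneg _

theorem distSig_le_sqrt_mul_infDist (hH₁ : H₁.PosDef) (hH₂ : H₂.PosDef) {C : Set (PD n d)}
    (hC : C.Nonempty) (x : PD n d) :
    distSig H₁ H₂ x C ≤ √(lamMax H₁ H₂) * Metric.infDist x C := by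
  have hM : 0 < √(lamMax H₁ H₂) := Real.sqrt_pos.2 (one_pos.trans_le one_le_lamMax)
  rw [mul_comm, ← div_le_iff₀ hM, Metric.le_infDist hC]
  intro w hw
  rw [div_le_iff₀ hM, dist_eq_norm]
  refine (distSig_le x hw).trans ?_
  rw [normSig_eq hH₁ hH₂]
  refine le_of_sq_le_sq ?_ (by positivity)
  rw [mul_pow, Real.sq_sqrt (zero_le_one.trans one_le_lamMax), mul_comm]
  exact le_lamMax_mul hH₁ hH₂ _

theorem ErrorBound.infDist_le {κ r : ℝ} (hκ : 0 < κ) (h : ErrorBound P κ r) {x g : PD n d}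
    (hx : Metric.infDist x P.Lam ≤ r) (hg : g ∈ P.Tl x) :
    Metric.infDist x P.Lam ≤ κ * ‖g‖ := by
  have h1 := (h x hx).trans (mul_le_mul_right (Metric.infEDist_le_edist_of_mem hg) _)
  rw [edist_dist, dist_zero_left, ← ENNReal.ofReal_mul hκ.le] at h1
  exact (ENNReal.ofReal_le_ofReal_iff (by positivity)).1 h1

theorem IsIterates.snd_eq_update (hz : IsIterates P H₁ H₂ σ ε z) (k : ℕ) :
    (z (k + 1)).snd = P.update (σ k) (z k).snd (z (k + 1)).fst :=
  WithLp.ofLp_injective 2 (Prod.ext (hz.update_u k) (hz.update_v k))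

/-- The displacements that turn the inexact steps into exact proximal point steps. -/
theorem IsIterates.exists_displacement (hz : IsIterates P H₁ H₂ σ ε z) (hDne : P.D.Nonempty)
    (hDcl : IsClosed P.D) (hDcv : Convex ℝ P.D) (hH₁ : H₁.PosDef) (hH₂ : H₂.PosDef)
    (hσ : ∀ k, 0 < σ k) :
    ∃ a : ℕ → PD n d, (∀ k, (σ k)⁻¹ • sigOp H₁ H₂ (a k - z (k + 1)) ∈ P.Tl (z (k + 1))) ∧
      ∀ k t, 0 ≤ t → ‖gradient (Phi P H₁ H₂ (σ k) (z k)) (z (k + 1)).fst‖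
        ≤ √(lamMin H₁ H₂) / σ k * t → ‖sqrtOp hH₁ hH₂ (a k - z k)‖ ≤ t := by
  -- Solve Σbₖ = σₖ(∇Φₖ, 0) and put aᵏ = zᵏ + bₖ. The free bound t serves (A) with εₖ and (B) with
  -- δₖ‖zᵏ⁺¹ - zᵏ‖_Σ.
  choose b hb using fun k => sigOp_surjective hH₁ hH₂
    (σ k • (WithLp.toLp 2 (gradient (Phi P H₁ H₂ (σ k) (z k)) (z (k + 1)).fst, 0) : PD n d))
  refine ⟨fun k => z k + b k, fun k => ?_, fun k t ht hle => ?_⟩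
  · have h := step_mem_Tl hDne hDcl hDcv hH₁ hH₂ (hσ k) (hz.snd_eq_update k)
    convert h using 1
    rw [add_sub_right_comm, map_add, hb, smul_add, smul_smul, inv_mul_cancel₀ (hσ k).ne',
      one_smul]
  · rw [add_sub_cancel_left]
    refine norm_displacement_le (inner_sigOp hH₁ hH₂) (lamMin_mul_le hH₁ hH₂)
      (sigOp_injective hH₁ hH₂) (hσ k) ?_ (hb k) ht
    rw [WithLp.norm_toLp_fst]
    exact hle

/-- Explains the radius r: no iterate leaves the weighted r-neighbourhood of Λ. -/
theorem distSig_le_tsum_add {a : ℕ → PD n d} (hDne : P.D.Nonempty) (hDcl : IsClosed P.D)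
    (hDcv : Convex ℝ P.D) (hH₁ : H₁.PosDef) (hH₂ : H₂.PosDef) (hε : ∀ k, 0 ≤ ε k)
    (hεs : Summable ε) (hσ : ∀ k, 0 < σ k) (hne : P.Lam.Nonempty)
    (hppa : IsInexactPPA P.Tl (sqrtOp hH₁ hH₂) (sigOp H₁ H₂) σ ε z a) (k : ℕ) :
    distSig H₁ H₂ (z k) P.Lam ≤ (∑' k, ε k) + distSig H₁ H₂ (z 0) P.Lam := by
  refine le_of_forall_gt_imp_ge_of_dense fun t ht => ?_
  obtain ⟨w, hw, hwt⟩ := exists_normSig_lt hne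
    (show distSig H₁ H₂ (z 0) P.Lam < t - ∑' k, ε k by linarith)
  have hw0 : (0 : PD n d) ∈ P.Tl w := hw
  have h := hppa.norm_le_add_tsum (isMonotoneOp_Tl hDne hDcl hDcv) (inner_sigOp hH₁ hH₂) hσ hε hεs
    hw0 k
  have h' := distSig_le (H₁ := H₁) (H₂ := H₂) (z k) hw
  rw [normSig_eq hH₁ hH₂] at h' hwt
  linarith

/-- The error bound near `Λ` controls the weighted distance on the whole weighted neighbourhood. -/
theorem distSig_le_of_errorBound (hDne : P.D.Nonempty) (hDcl : IsClosed P.D)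
    (hDcv : Convex ℝ P.D) (hH₁ : H₁.PosDef) (hH₂ : H₂.PosDef) (hne : P.Lam.Nonempty)
    {κ r : ℝ} (hκ : 0 < κ) (hr : 0 ≤ r) (hEB : ErrorBound P κ r) {x g : PD n d} (hg : g ∈ P.Tl x)
    (hx : distSig H₁ H₂ x P.Lam ≤ r) :
    distSig H₁ H₂ x P.Lam ≤ √(lamMax H₁ H₂) * (κ * ‖g‖) := by
  -- The Euclidean distance may exceed r although the weighted one does not; then r ≤ κ‖g‖ replaces
  -- the error bound.
  rcases le_total (Metric.infDist x P.Lam) r with hle | hle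
  · exact (distSig_le_sqrt_mul_infDist hH₁ hH₂ hne _).trans
      (mul_le_mul_of_nonneg_left (hEB.infDist_le hκ hle hg) (Real.sqrt_nonneg _))
  · have h : r ≤ κ * ‖g‖ := le_mul_norm_of_le_infDist (isMonotoneOp_Tl hDne hDcl hDcv)
      (exists_sub_smul_mem_Tl hDne hDcl hDcv) hκ hr hne
      (fun x g hx hg' => hx.symm.trans_le (hEB.infDist_le hκ hx.le hg')) hg hle
    have hM1 : 1 ≤ √(lamMax H₁ H₂) := Real.one_le_sqrt.2 one_le_lamMax
    exact (hx.trans h).trans (le_mul_of_one_le_left (by positivity) hM1)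

theorem distSig_succ_le {a : ℕ → PD n d} (hDne : P.D.Nonempty) (hDcl : IsClosed P.D)
    (hDcv : Convex ℝ P.D) (hH₁ : H₁.PosDef) (hH₂ : H₂.PosDef) (hε : ∀ k, 0 ≤ ε k)
    (hεs : Summable ε) (hσ : ∀ k, 0 < σ k) (hne : P.Lam.Nonempty)
    (hppa : IsInexactPPA P.Tl (sqrtOp hH₁ hH₂) (sigOp H₁ H₂) σ ε z a)
    (hclose : ∀ k t, 0 ≤ t → ‖gradient (Phi P H₁ H₂ (σ k) (z k)) (z (k + 1)).fst‖
        ≤ √(lamMin H₁ H₂) / σ k * t → ‖sqrtOp hH₁ hH₂ (a k - z k)‖ ≤ t)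
    {κ : ℝ} (hκ : 0 < κ)
    (hEB : ErrorBound P κ ((∑' k, ε k) + distSig H₁ H₂ (z 0) P.Lam))
    {δ : ℕ → ℝ} (hδ0 : ∀ k, 0 ≤ δ k) (hδ1 : ∀ k, δ k < 1) (hB : CritB P H₁ H₂ σ δ z) (k : ℕ) :
    distSig H₁ H₂ (z (k + 1)) P.Lam
      ≤ mu κ (lamMax H₁ H₂) (σ k) (δ k) * distSig H₁ H₂ (z k) P.Lam := by
  have hg := hppa.step k
  have hbound := distSig_le_of_errorBound hDne hDcl hDcv hH₁ hH₂ hne hκ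
    (add_nonneg (tsum_nonneg hε) (distSig_nonneg _ _)) hEB hg
    (distSig_le_tsum_add hDne hDcl hDcv hH₁ hH₂ hε hεs hσ hne hppa (k + 1))
  have hdisp : ‖sqrtOp hH₁ hH₂ (a k - z k)‖ ≤ δ k * ‖sqrtOp hH₁ hH₂ (z (k + 1) - z k)‖ := by
    refine hclose k _ (mul_nonneg (hδ0 k) (norm_nonneg _)) ((hB k).trans_eq ?_)
    rw [normSig_eq hH₁ hH₂]
    ring
  have hle : ∀ w, 0 ∈ P.Tl w →
      distSig H₁ H₂ (z (k + 1)) P.Lam ≤ ‖sqrtOp hH₁ hH₂ (z (k + 1) - w)‖ := fun w hw => by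
    rw [← normSig_eq hH₁ hH₂]
    exact distSig_le _ hw
  have hlt : ∀ t, distSig H₁ H₂ (z k) P.Lam < t →
      ∃ w, 0 ∈ P.Tl w ∧ ‖sqrtOp hH₁ hH₂ (z k - w)‖ < t := fun t ht => by
    obtain ⟨w, hw, hwt⟩ := exists_normSig_lt hne ht
    rw [normSig_eq hH₁ hH₂] at hwt
    exact ⟨w, hw, hwt⟩
  exact dist_step_le_mu_mul (isMonotoneOp_Tl hDne hDcl hDcv) (inner_sigOp hH₁ hH₂) one_le_lamMax
    (le_lamMax_mul hH₁ hH₂) (hσ k) hκ (hδ0 k) (hδ1 k) hg hdisp (distSig_nonneg _ _) hle hlt hbound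

end Main
end ProxALM

end

theorem theorem2 {n d : ℕ} (P : ProxALM.Data n d)
    (hDne : P.D.Nonempty) (hDcl : IsClosed P.D) (hDcv : Convex ℝ P.D)
    (H₁ : Matrix (Fin n) (Fin n) ℝ) (H₂ : Matrix (Fin n × Fin d) (Fin n × Fin d) ℝ)
    (hH₁ : H₁.PosDef) (hH₂ : H₂.PosDef)
    (ε : ℕ → ℝ) (hε : ∀ k, 0 ≤ ε k) (hεs : Summable ε)
    (σ : ℕ → ℝ) (hσ0 : 0 < σ 0) (hσm : Monotone σ)
    (σinf : EReal) (hσlim : Tendsto (fun k => (σ k : EReal)) atTop (𝓝 σinf))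
    (z : ℕ → ProxALM.PD n d) (hz : ProxALM.IsIterates P H₁ H₂ σ ε z)
    (hkkt : P.kktSet.Nonempty) :
    P.kktSet = P.Lam ∧
    (Bornology.IsBounded (Set.range z) ∧
      (∃ x, P.IsPrimalOptimal x ∧ Tendsto (fun k => (z k).fst) atTop (𝓝 x)) ∧
      (∃ y, P.IsDualOptimal y ∧ Tendsto (fun k => (z k).snd) atTop (𝓝 y))) ∧
    (∀ κ : ℝ, 0 < κ →
      ProxALM.ErrorBound P κ ((∑' k, ε k) + ProxALM.distSig H₁ H₂ (z 0) P.Lam) →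
      ∀ δ : ℕ → ℝ, (∀ k, 0 ≤ δ k ∧ δ k < 1) → Summable δ →
      ProxALM.CritB P H₁ H₂ σ δ z →
      (∀ k, ProxALM.distSig H₁ H₂ (z (k + 1)) P.Lam
        ≤ ProxALM.mu κ (ProxALM.lamMax H₁ H₂) (σ k) (δ k)
          * ProxALM.distSig H₁ H₂ (z k) P.Lam) ∧
      Tendsto (fun k => ProxALM.mu κ (ProxALM.lamMax H₁ H₂) (σ k) (δ k)) atTop
        (𝓝 (ProxALM.muInf κ (ProxALM.lamMax H₁ H₂) σinf)) ∧
      ProxALM.muInf κ (ProxALM.lamMax H₁ H₂) σinf < 1 ∧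
      Tendsto (fun s : ℝ => ProxALM.muInf κ (ProxALM.lamMax H₁ H₂) (s : EReal)) atTop
        (𝓝 0)) := by
  have hσ : ∀ k, 0 < σ k := fun k => hσ0.trans_le (hσm (Nat.zero_le k))
  have hLam := ProxALM.kktSet_eq_Lam hDne hDcl hDcv
  have hT := ProxALM.isMonotoneOp_Tl hDne hDcl hDcv
  have hS := ProxALM.inner_sigOp hH₁ hH₂
  have hM := ProxALM.le_lamMax_mul hH₁ hH₂
  have hne : P.Lam.Nonempty := hLam ▸ hkkt
  obtain ⟨a, hstep, hclose⟩ := hz.exists_displacement hDne hDcl hDcv hH₁ hH₂ hσ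
  have hppa : ProxALM.IsInexactPPA P.Tl (ProxALM.sqrtOp hH₁ hH₂) (ProxALM.sigOp H₁ H₂) σ ε z a :=
    ⟨hstep, fun k => hclose k _ (hε k) (hz.critA k)⟩
  refine ⟨hLam, ?_, fun κ hκ hEB δ hδ hδs hB => ⟨fun k => ?_, ?_, ?_, ?_⟩⟩
  · obtain ⟨w, hw, hlim⟩ := hppa.exists_tendsto hT (ProxALM.mem_Tl_of_tendsto hDne hDcl hDcv) hS
      (ProxALM.sqrtOp_injective hH₁ hH₂) hM hσ0 hσm hε hεs hne
    exact ⟨Metric.isBounded_range_of_tendsto z hlim,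
      ⟨w.fst, ProxALM.isPrimalOptimal_of_mem_Lam hDne hDcl hDcv hw,
        ((by fun_prop : Continuous fun z : ProxALM.PD n d => z.fst).tendsto w).comp hlim⟩,
      ⟨w.snd, ProxALM.isDualOptimal_of_mem_Lam hDne hDcl hDcv hw,
        ((by fun_prop : Continuous fun z : ProxALM.PD n d => z.snd).tendsto w).comp hlim⟩⟩
  · exact ProxALM.distSig_succ_le hDne hDcl hDcv hH₁ hH₂ hε hεs hσ hne hppa hclose hκ hEB
      (fun k => (hδ k).1) (fun k => (hδ k).2) hB k
  · exact ProxALM.tendsto_mu hκ ProxALM.one_le_lamMax hσm hσlim hδs.tendsto_atTop_zero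
  · refine ProxALM.muInf_lt_one hκ ProxALM.one_le_lamMax (lt_of_lt_of_le (b := (σ 0 : EReal))
      (by exact_mod_cast hσ0) (ge_of_tendsto hσlim (Eventually.of_forall fun k =>
        EReal.coe_le_coe_iff.2 (hσm (Nat.zero_le k)))))
  · exact ProxALM.tendsto_muInf _ _
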